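/- **Theorem C2.43.** Let $G$ be a group (not necessarily finitely generated) and let $\chi\colon G\to\mathbb{R}$ be a non-zero character, i.e. a non-zero homomorphism into the additive group of $\mathbb{R}$. Then the following four statements are equivalent: 1. $[\chi]\in\Sigma^1(G)$; 2. for every generating system $\eta\colon\mathcal{X}\to G$ the measured tree $T(G,\mathcal{X},\chi)$ is a line; 3. every measured $G$-tree $(T,\le,\lambda)$ with associated character $\chi_T=\chi$ contains a $G$-invariant line; 4. every $(G,\mathbb{R})$-tree $(T,d)$ such that $G$ fixes an end $e$ of $(T,d)$ and the character associated to this end coincides with $\chi$ contains a $G$-invariant line. Here the terms have the following meaning. *Cayley graphs and $\Sigma^1$.* A generating system of $G$ is a map $\eta\colon\mathcal{X}\to G$ whose image generates $G$; the Cayley graph $\Gamma(G,\mathcal{X})$ has vertex set $G$ and edges joining $g$ to $g\,\eta(x)$ for $g\in G$, $x\in\mathcal{X}$. For $r\in\mathbb{R}$ let $\Gamma(G,\mathcal{X})_\chi^{[r,\infty)}$ be its full subgraph on $\{g\mid\chi(g)\ge r\}$, and put $\Gamma(G,\mathcal{X})_\chi=\Gamma(G,\mathcal{X})_\chi^{[0,\infty)}$.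 The ray of a non-zero character $\chi$ in $\operatorname{Hom}(G,\mathbb{R})$ is $[\chi]=\{s\chi\mid s>0\}$, and $\Sigma^1(G)$ is the set of those rays $[\chi]$ for which $\Gamma(G,\mathcal{X})_\chi$ is connected for every generating system $\mathcal{X}$ of $G$. *Measured trees.* A measured tree is a triple $(T,\le,\lambda)$ consisting of a non-empty partially ordered set $(T,\le)$ in which every finite subset has a lower bound and every ray $(-\infty,a]=\{b\mid b\le a\}$ is linearly ordered, and a function $\lambda\colon T\to\mathbb{R}$ which maps each ray injectively and in an order-preserving way onto a subset of $\mathbb{R}$ that is not bounded from below. A subset $L\subseteq T$ is a line if it is linearly ordered, contains the ray $(-\infty,a]$ for each $a\in L$, and $\lambda(L)$ is not bounded from above. A measured $G$-tree is a measured tree on which $G$ acts in such a way that for each $g\in G$ the map $a\mapsto g.a$ is order-preserving and $\lambda(g.a)-\lambda(a)$ does not depend on $a$; its associated character is $\chi_T(g)=\lambda(g.a)-\lambda(a)$. The measured tree $T(G,\mathcal{X},\chi)$ is the set of all connected components $\mathcal{C}$ of the graphs $\Gamma(G,\mathcal{X})_\chi^{[r,\infty)}$ with $r\in\operatorname{im}\chi$,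 with $\mathcal{C}\le\mathcal{C}'\iff\mathcal{C}\supseteq\mathcal{C}'$ and $\lambda(\mathcal{C})=\inf\{\chi(h)\mid h\in\mathcal{C}\}$; it is a line if the whole set $T(G,\mathcal{X},\chi)$ is a line in the above sense. *$(G,\mathbb{R})$-trees.* An $\mathbb{R}$-tree is a metric space $(T,d)$ in which any two points $a,b$ are joined by a unique geodesic arc, with image $[a,b]$, and in which $[a,b]\cap[b,c]=\{b\}$ implies $[a,b]\cup[b,c]=[a,c]$; it is a $(G,\mathbb{R})$-tree if $G$ acts on it by isometries. An end $e$ is an equivalence class of infinite geodesic rays, two rays being equivalent if they have a common subray. For each $a\in T$ there is a unique ray $(-\infty,a]$ with end point $a$ that represents $e$; put $a_1\le a_2$ if $(-\infty,a_1]\subseteq(-\infty,a_2]$. With a base point $b_*\in T$ set $\lambda(x)=d(c,x)-d(c,b_*)$ for any $c$ with $c\le x$ and $c\le b_*$ (the value does not depend on $c$). If $G$ fixes $e$, the character associated to $e$ is $g\mapsto\lambda(g.x)-\lambda(x)$, which depends neither on $x$ nor on $b_*$. A line in an $\mathbb{R}$-tree is the image of an isometric embedding $\mathbb{R}\to T$.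 -/

import Mathlib

universe u

namespace SigmaOne

/-! ### Characters, generating systems, Cayley graphs and the invariant `Σ¹` -/

section Sigma

variable {G : Type u} [Group G]

/-- A character of `G` is a homomorphism of `G` into the additive group of the reals.
These form a real vector space. -/
abbrev Character (G : Type u) [Group G] : Type u := Additive G →+ ℝ

/-- The value of the character `χ` at the group element `g`. -/
def Character.val (χ : Character G) (g : G) : ℝ := χ (Additive.ofMul g)

/-- A generating system of `G` is a map `η : X → G` whose image generates `G`. -/
def IsGeneratingSystem {X : Type u} (η : X → G) : Prop :=
  Subgroup.closure (Set.range η) = ⊤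

/-- The full subgraph of the Cayley graph `Γ(G, X)` (edges join `g` to `g * η x`) on the vertices
`g` with `χ g ≥ r`. Orientation, loops and multiplicities of edges are forgotten, since only
connected components matter. -/
def upperGraph {X : Type u} (η : X → G) (χ : Character G) (r : ℝ) :
    SimpleGraph {g : G | r ≤ χ.val g} :=
  (SimpleGraph.mulCayley (Set.range η)).induce {g : G | r ≤ χ.val g}

/-- The character sphere: the set of rays `[χ]` with `χ` a non-zero character. -/
abbrev CharacterSphere (G : Type u) [Group G] : Type u := Module.Ray ℝ (Character G)

/-- The invariant `Σ¹(G)`: the set of all `[χ]` such that the subgraph of `Γ(G, X)` on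
`{g | χ g ≥ 0}` is connected for every generating system `η : X → G`. -/
def sigmaOne (G : Type u) [Group G] : Set (CharacterSphere G) :=
  {ρ | ∃ (χ : Character G) (hχ : χ ≠ 0), ρ = rayOfNeZero ℝ χ hχ ∧
    ∀ (X : Type u) (η : X → G), IsGeneratingSystem η → (upperGraph η χ 0).Connected}

end Sigma

/-! ### Measured trees -/

section Measured

variable {T : Type u} [PartialOrder T]

/-- `(T, ≤, lam)` is a measured tree. -/
structure IsMeasuredTree (lam : T → ℝ) : Prop where
  nonempty : Nonempty T
  bddBelow_of_finite : ∀ s : Set T, s.Finite → BddBelow s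
  isChain_ray : ∀ a : T, IsChain (· ≤ ·) (Set.Iic a)
  injOn_ray : ∀ a : T, Set.InjOn lam (Set.Iic a)
  monotoneOn_ray : ∀ a : T, MonotoneOn lam (Set.Iic a)
  not_bddBelow_ray : ∀ a : T, ¬ BddBelow (lam '' Set.Iic a)

/-- A line of `(T, ≤, lam)`: a linearly ordered subset that contains the ray descending from each
of its elements and on which `lam` is not bounded from above. -/
structure IsMeasuredLine (lam : T → ℝ) (L : Set T) : Prop where
  isChain : IsChain (· ≤ ·) L
  ray_subset : ∀ a ∈ L, Set.Iic a ⊆ L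
  not_bddAbove : ¬ BddAbove (lam '' L)

/-- A morphism of measured trees (here from a measured tree to itself). -/
def IsMeasuredEndomorphism (lam : T → ℝ) (φ : T → T) : Prop :=
  Monotone φ ∧ ∃ r : ℝ, ∀ a, lam (φ a) = lam a + r

/-- A measured `G`-tree: a measured tree on which the group `G` acts by morphisms. -/
structure IsMeasuredGTree (G : Type u) [Group G] [MulAction G T] (lam : T → ℝ) : Prop
    extends IsMeasuredTree lam where
  morphism : ∀ g : G, IsMeasuredEndomorphism lam (fun a : T => g • a)

end Measured

/-- The function `g ↦ lam (g • a) - lam a` does not depend on the point `a` and is equal to `χ`. -/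
def HasAssociatedCharacter {G : Type u} [Group G] {T : Type u} [MulAction G T]
    (lam : T → ℝ) (χ : Character G) : Prop :=
  ∀ (g : G) (a : T), lam (g • a) - lam a = χ.val g

/-- `L` is `G`-invariant. -/
def IsInvariantSet (G : Type u) [Group G] {T : Type u} [MulAction G T] (L : Set T) : Prop :=
  ∀ g : G, (fun x : T => g • x) '' L = L

/-! ### The measured tree `T(G, X, χ)` -/

section CayleyTree

variable {G : Type u} [Group G] {X : Type u}

/-- The points of `T(G, X, χ)`: the connected components of the graphs `upperGraph η χ r`, with `r`
in the image of `χ`. These are full subgraphs of the Cayley graph, and are represented by their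
vertex sets. -/
def CayleyTree (η : X → G) (χ : Character G) : Type u :=
  {C : Set G // ∃ r ∈ Set.range χ.val, ∃ c : (upperGraph η χ r).ConnectedComponent,
    C = Subtype.val '' c.supp}

/-- The order of `T(G, X, χ)` is reverse inclusion. -/
instance CayleyTree.instPartialOrder (η : X → G) (χ : Character G) :
    PartialOrder (CayleyTree η χ) where
  le C C' := C'.1 ⊆ C.1
  le_refl C := Set.Subset.refl C.1
  le_trans _ _ _ h h' := Set.Subset.trans h' h
  le_antisymm _ _ h h' := Subtype.ext (Set.Subset.antisymm h' h)

/-- The measure of `T(G, X, χ)`: the infimum of `χ` on a component. -/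
noncomputable def CayleyTree.lam (η : X → G) (χ : Character G) (C : CayleyTree η χ) : ℝ :=
  sInf (χ.val '' C.1)

end CayleyTree

/-! ### `ℝ`-trees, their ends and the associated measures -/

section RTree

variable {T : Type u} [MetricSpace T]

/-- `γ` is a geodesic arc from `a` to `b`, parametrized by `[0, d(a, b)]`. -/
def IsGeodesicArc (a b : T) (γ : Set.Icc (0 : ℝ) (dist a b) → T) : Prop :=
  Isometry γ ∧ γ ⟨0, le_refl 0, dist_nonneg⟩ = a ∧ γ ⟨dist a b, dist_nonneg, le_refl _⟩ = b

/-- The geodesic segment `[a, b]`, the image of the geodesic arc from `a` to `b`. -/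
def geodesicSegment (a b : T) : Set T :=
  {x | ∃ γ, IsGeodesicArc a b γ ∧ x ∈ Set.range γ}

/-- `ℝ`-trees: any two points are joined by a unique geodesic arc, and two segments `[a, b]`,
`[b, c]` having only `b` in common make up the segment `[a, c]`. -/
structure IsRTree (T : Type u) [MetricSpace T] : Prop where
  existsUnique_arc : ∀ a b : T, ∃! γ, IsGeodesicArc a b γ
  union_segment : ∀ a b c : T, geodesicSegment a b ∩ geodesicSegment b c = {b} →
    geodesicSegment a b ∪ geodesicSegment b c = geodesicSegment a c

/-- A geodesic ray of infinite length, parametrized by the distance from its end point. -/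
structure GeodesicRay (T : Type u) [MetricSpace T] where
  toFun : NNReal → T
  isometry : Isometry toFun

/-- Two geodesic rays represent the same end if they have a common subray. -/
def GeodesicRay.Equivalent (ρ σ : GeodesicRay T) : Prop :=
  ∃ s t : NNReal, ∀ v : NNReal, ρ.toFun (s + v) = σ.toFun (t + v)

/-- The relation `GeodesicRay.Equivalent` is an equivalence relation. -/
instance GeodesicRay.setoid (T : Type u) [MetricSpace T] : Setoid (GeodesicRay T) where
  r := GeodesicRay.Equivalent
  iseqv :=
    { refl := fun _ => ⟨0, 0, fun _ => rfl⟩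
      symm := fun ⟨s, t, h⟩ => ⟨t, s, fun v => (h v).symm⟩
      trans := by
        rintro ρ σ τ ⟨s, t, h⟩ ⟨s', t', h'⟩
        refine ⟨s + s', t' + t, fun v => ?_⟩
        rw [add_assoc, h, add_assoc t', ← h', ← add_assoc, ← add_assoc, add_comm t s'] }

/-- An end: an equivalence class of geodesic rays. -/
def TreeEnd (T : Type u) [MetricSpace T] : Type u := Quotient (GeodesicRay.setoid T)

/-- The geodesic ray `(-∞, a]` that represents the end `e` and has end point `a`, as a set. -/
def descendingRay (e : TreeEnd T) (a : T) : Set T :=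
  {x | ∃ ρ : GeodesicRay T, (Quotient.mk _ ρ : TreeEnd T) = e ∧ ρ.toFun 0 = a ∧
    x ∈ Set.range ρ.toFun}

/-- The order relation attached to the end `e`. -/
def endLE (e : TreeEnd T) (a₁ a₂ : T) : Prop := descendingRay e a₁ ⊆ descendingRay e a₂

/-- The measure attached to the end `e` and the base point `b`: one has
`endMeasure e b x = d(c, x) - d(c, b)` for any `c` with `c ≤ x` and `c ≤ b`; in an `ℝ`-tree such
`c` exist and the value does not depend on the choice of `c`. -/
noncomputable def endMeasure (e : TreeEnd T) (b x : T) : ℝ :=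
  let c := @Classical.epsilon T ⟨b⟩ (fun c => endLE e c x ∧ endLE e c b)
  dist c x - dist c b

/-- A (geodesic) line: an isometrically embedded copy of `ℝ`. -/
def IsGeodesicLine (L : Set T) : Prop := ∃ φ : ℝ → T, Isometry φ ∧ Set.range φ = L

variable (G : Type u) [Group G] [MulAction G T] [IsIsometricSMul G T]

variable {G} in
/-- The translate of a geodesic ray by a group element. -/
def GeodesicRay.translate (g : G) (ρ : GeodesicRay T) : GeodesicRay T where
  toFun v := g • ρ.toFun v
  isometry := (isometry_smul T g).comp ρ.isometry

variable {G} in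
/-- The translate of an end by a group element. -/
def TreeEnd.translate (g : G) : TreeEnd T → TreeEnd T :=
  Quotient.map (GeodesicRay.translate g) (by
    rintro ρ σ ⟨s, t, h⟩
    exact ⟨s, t, fun v => congrArg (fun x => g • x) (h v)⟩)

/-- The group `G` fixes the end `e`. -/
def FixesEnd (e : TreeEnd T) : Prop := ∀ g : G, TreeEnd.translate g e = e

end RTree

end SigmaOne

/-!
The points of `T(G, X, χ)` are the components of the graphs `upperGraph η χ r`, so this tree is
linearly ordered, and then a line, if and only if these graphs are connected.

If they are, a measured `G`-tree with character `χ` contains an invariant line: choose `t` with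
`χ t > 0` and a point `c ≤ t • c`. The elements of `G` that move `c` upwards generate `G`, and
following paths of the corresponding Cayley graph in `{g | χ g ≥ 0}` one finds `c ≤ g • c` whenever
`χ g ≥ 0`. So the orbit of `c` is linearly ordered, and the points below it form the line. The order
attached to a fixed end turns an `ℝ`-tree into a measured tree, which settles the `ℝ`-trees.

Conversely, the supremum of the levels `r` at which `g` and `h` lie in the same component of
`upperGraph η χ r` is an ultrametric kernel on `G`. It defines an `ℝ`-tree, made up of one
descending ray for each `g`, on which `G` acts with a fixed end and character `χ`. Any two points of
an invariant line are comparable, so there is a level at which `1` can be joined to every `h` with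
`χ h ≥ 0`. Translation by an element of large value lifts these paths above the level `0`.
-/

namespace SigmaOne

section Characters

variable {G : Type u} [Group G] (χ : Character G)

@[simp] theorem Character.val_one : χ.val 1 = 0 := map_zero χ

@[simp] theorem Character.val_mul (g h : G) : χ.val (g * h) = χ.val g + χ.val h :=
  map_add χ (Additive.ofMul g) (Additive.ofMul h)

@[simp] theorem Character.val_inv (g : G) : χ.val g⁻¹ = -χ.val g :=
  map_neg χ (Additive.ofMul g)

@[simp] theorem Character.val_pow (g : G) (n : ℕ) : χ.val (g ^ n) = n * χ.val g := by
  rw [val, ofMul_pow, map_nsmul, nsmul_eq_mul]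
  rfl

variable {χ}

theorem Character.exists_lt_val_pow {t : G} (ht : 0 < χ.val t) (r : ℝ) :
    ∃ n : ℕ, r < χ.val (t ^ n) := by
  obtain ⟨n, hn⟩ := exists_nat_gt (r / χ.val t)
  exact ⟨n, by rwa [val_pow, ← div_lt_iff₀ ht]⟩

theorem Character.exists_val_pos (hχ : χ ≠ 0) : ∃ t : G, 0 < χ.val t := by
  by_contra! h
  refine hχ (AddMonoidHom.ext fun g => le_antisymm (h g.toMul) ?_)
  have hinv := h g.toMul⁻¹
  rw [val_inv] at hinv
  exact neg_nonpos.1 hinv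

theorem Character.exists_lt_val (hχ : χ ≠ 0) (r : ℝ) : ∃ g : G, r < χ.val g := by
  obtain ⟨t, ht⟩ := exists_val_pos hχ
  obtain ⟨n, hn⟩ := exists_lt_val_pow ht r
  exact ⟨t ^ n, hn⟩

theorem IsGeneratingSystem.exists_val_ne_zero {X : Type u} {η : X → G}
    (hη : IsGeneratingSystem η) (hχ : χ ≠ 0) : ∃ x, χ.val (η x) ≠ 0 := by
  by_contra! h
  refine hχ (AddMonoidHom.toMultiplicativeRight.injective
    (MonoidHom.eq_of_eqOn_dense hη ?_))
  rintro _ ⟨x, rfl⟩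
  exact h x

end Characters

section JoinedAbove

variable {G : Type u} [Group G] {X : Type u} {η : X → G} {χ : Character G} {r s : ℝ} {g h k : G}

/-- The elements `g` and `h` lie in the same component of `upperGraph η χ r`. This is a relation
between elements of `G`, rather than vertices of the subgraph, in order to vary the level `r`. -/
def JoinedAbove (η : X → G) (χ : Character G) (r : ℝ) (g h : G) : Prop :=
  ∃ (hg : r ≤ χ.val g) (hh : r ≤ χ.val h), (upperGraph η χ r).Reachable ⟨g, hg⟩ ⟨h, hh⟩

namespace JoinedAbove

theorem refl (hg : r ≤ χ.val g) : JoinedAbove η χ r g g := ⟨hg, hg, .refl _⟩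

theorem symm : JoinedAbove η χ r g h → JoinedAbove η χ r h g :=
  fun ⟨hg, hh, p⟩ => ⟨hh, hg, p.symm⟩

theorem trans : JoinedAbove η χ r g h → JoinedAbove η χ r h k → JoinedAbove η χ r g k :=
  fun ⟨hg, _, p⟩ ⟨_, hk, q⟩ => ⟨hg, hk, p.trans q⟩

theorem le_left (H : JoinedAbove η χ r g h) : r ≤ χ.val g := H.1

theorem mul_generator {x : X} (hg : r ≤ χ.val g) (hx : r ≤ χ.val (g * η x)) :
    JoinedAbove η χ r g (g * η x) := by
  by_cases h : g = g * η x
  · rw [← h]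
    exact refl hg
  · refine ⟨hg, hx, SimpleGraph.Adj.reachable ?_⟩
    exact (SimpleGraph.mulCayley_adj' _ _ _).2 ⟨h, η x, ⟨x, rfl⟩, Or.inl rfl⟩

theorem mono (hsr : s ≤ r) : JoinedAbove η χ r g h → JoinedAbove η χ s g h :=
  fun ⟨hg, hh, p⟩ => ⟨hsr.trans hg, hsr.trans hh,
    p.map (SimpleGraph.induceHomOfLE _ fun _ => hsr.trans).toHom⟩

theorem mul_left (k : G) :
    JoinedAbove η χ r g h → JoinedAbove η χ (χ.val k + r) (k * g) (k * h) := by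
  have level {l : G} (hl : r ≤ χ.val l) : χ.val k + r ≤ χ.val (k * l) := by
    rw [Character.val_mul]
    exact add_le_add_right hl _
  have adj {u v : G} (huv : (SimpleGraph.mulCayley (Set.range η)).Adj u v) :
      (SimpleGraph.mulCayley (Set.range η)).Adj (k * u) (k * v) := by
    simpa only [SimpleGraph.mulCayley_adj', mul_assoc, ne_eq, mul_right_inj] using huv
  let translate : upperGraph η χ r →g upperGraph η χ (χ.val k + r) :=
    ⟨fun l => ⟨k * l, level l.2⟩, adj⟩
  exact fun ⟨hg, hh, p⟩ => ⟨level hg, level hh, p.map translate⟩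

end JoinedAbove

theorem IsGeneratingSystem.exists_joinedAbove (hη : IsGeneratingSystem η) (χ : Character G)
    (g h : G) : ∃ r, JoinedAbove η χ r g h := by
  suffices ∀ k g : G, ∃ r, JoinedAbove η χ r g (g * k) by
    simpa using this (g⁻¹ * h) g
  intro k
  have hk : k ∈ Subgroup.closure (Set.range η) := hη ▸ Subgroup.mem_top k
  induction hk using Subgroup.closure_induction with
  | mem k hk =>
    obtain ⟨x, rfl⟩ := hk
    exact fun g => ⟨_, .mul_generator (min_le_left _ (χ.val (g * η x))) (min_le_right _ _)⟩
  | one => exact fun g => ⟨χ.val g, by simpa using .refl le_rfl⟩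
  | mul a b _ _ iha ihb =>
    intro g
    obtain ⟨r, hr⟩ := iha g
    obtain ⟨s, hs⟩ := ihb (g * a)
    refine ⟨min r s, ?_⟩
    rw [← mul_assoc]
    exact (hr.mono (min_le_left _ _)).trans (hs.mono (min_le_right _ _))
  | inv a _ ih =>
    intro g
    obtain ⟨r, hr⟩ := ih (g * a⁻¹)
    rw [inv_mul_cancel_right] at hr
    exact ⟨r, hr.symm⟩

theorem upperGraph_connected_iff :
    (upperGraph η χ 0).Connected ↔ ∀ g, 0 ≤ χ.val g → JoinedAbove η χ 0 1 g := by
  have h1 : 0 ≤ χ.val (1 : G) := χ.val_one.ge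
  refine ⟨fun H g hg => ⟨h1, hg, H.preconnected _ _⟩, fun H => ?_⟩
  have : Nonempty {g : G | 0 ≤ χ.val g} := ⟨⟨1, h1⟩⟩
  refine ⟨fun a b => ?_⟩
  obtain ⟨_, _, p⟩ := (H a a.2).symm.trans (H b b.2)
  exact p

theorem joinedAbove_val_of_connected (H : (upperGraph η χ 0).Connected)
    (hg : χ.val k ≤ χ.val g) (hh : χ.val k ≤ χ.val h) : JoinedAbove η χ (χ.val k) g h := by
  rw [upperGraph_connected_iff] at H
  have joined_base {l : G} (hl : χ.val k ≤ χ.val l) : JoinedAbove η χ (χ.val k) k l := by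
    simpa using (H (k⁻¹ * l) (by simpa using hl)).mul_left k
  exact (joined_base hg).symm.trans (joined_base hh)

theorem upperGraph_smul_connected_iff (hs : 0 < s) :
    (upperGraph η (s • χ) 0).Connected ↔ (upperGraph η χ 0).Connected := by
  have : {g : G | 0 ≤ (s • χ : Character G).val g} = {g | 0 ≤ χ.val g} :=
    Set.ext fun _ => mul_nonneg_iff_of_pos_left hs
  rw [upperGraph, upperGraph, this]

theorem rayOfNeZero_mem_sigmaOne_iff (hχ : χ ≠ 0) :
    rayOfNeZero ℝ χ hχ ∈ sigmaOne G ↔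
      ∀ (X : Type u) (η : X → G), IsGeneratingSystem η → (upperGraph η χ 0).Connected := by
  refine ⟨?_, fun H => ⟨χ, hχ, rfl, H⟩⟩
  rintro ⟨ψ, hψ, h, H⟩ X η hη
  obtain ⟨s, hs, rfl⟩ := ((ray_eq_iff hχ hψ).1 h).exists_pos_left hχ hψ
  exact (upperGraph_smul_connected_iff hs).1 (H X η hη)

theorem IsGeneratingSystem.exists_val_pos_joinedAbove_one (hη : IsGeneratingSystem η)
    (hχ : χ ≠ 0) : ∃ t, 0 < χ.val t ∧ JoinedAbove η χ 0 1 t := by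
  obtain ⟨x, hx⟩ := hη.exists_val_ne_zero hχ
  rcases hx.lt_or_gt with hx | hx
  · have hpos : 0 < χ.val (η x)⁻¹ := by simpa using hx
    refine ⟨(η x)⁻¹, hpos, .symm ?_⟩
    simpa using JoinedAbove.mul_generator (η := η) (x := x) hpos.le (by simp)
  · refine ⟨η x, hx, ?_⟩
    simpa using JoinedAbove.mul_generator (η := η) (x := x) χ.val_one.ge (by simpa using hx.le)

theorem JoinedAbove.pow (H : JoinedAbove η χ 0 1 g) (n : ℕ) : JoinedAbove η χ 0 1 (g ^ n) := by
  have hg : 0 ≤ χ.val g := H.symm.le_left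
  induction n with
  | zero => simpa using refl χ.val_one.ge
  | succ n ih =>
    have hstep : JoinedAbove η χ (χ.val (g ^ n) + 0) (g ^ n) (g ^ (n + 1)) := by
      simpa only [mul_one, ← pow_succ] using H.mul_left (g ^ n)
    refine ih.trans (hstep.mono ?_)
    rw [Character.val_pow]
    positivity

/- If `χ t > -r`, translating by `t` a path from `1` to `t⁻¹ * h * t` that stays above the level `r`
gives a path from `t` to `h * t` that stays above `0`; for `t` a power of a generator, the paths
from `1` to `t` and from `h` to `h * t` also stay above `0`. -/
theorem upperGraph_connected_of_joinedAbove (hη : IsGeneratingSystem η) (hχ : χ ≠ 0)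
    (H : ∀ h, 0 ≤ χ.val h → JoinedAbove η χ r 1 h) : (upperGraph η χ 0).Connected := by
  rw [upperGraph_connected_iff]
  intro h hh
  obtain ⟨s, hs, one_s⟩ := hη.exists_val_pos_joinedAbove_one hχ
  obtain ⟨n, hn⟩ := Character.exists_lt_val_pow hs (-r)
  have one_t : JoinedAbove η χ 0 1 (s ^ n) := one_s.pow n
  generalize s ^ n = t at hn one_t
  have h_ht : JoinedAbove η χ 0 h (h * t) := by
    simpa using (one_t.mul_left h).mono (s := 0) (by linarith)
  have t_ht : JoinedAbove η χ 0 t (h * t) := by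
    have := (H (t⁻¹ * (h * t)) (by simpa using hh)).mul_left t
    rw [mul_one, mul_inv_cancel_left] at this
    exact this.mono (by linarith)
  exact (one_t.trans t_ht).trans h_ht.symm

end JoinedAbove

section CayleyTree

variable {G : Type u} [Group G] {X : Type u} {η : X → G} {χ : Character G}

namespace CayleyTree

/-- The component of `g` in `upperGraph η χ (χ.val k)`, as a point of the tree `T(G, X, χ)`. -/
def component (η : X → G) (χ : Character G) {k g : G} (hg : χ.val k ≤ χ.val g) :
    CayleyTree η χ :=
  ⟨Subtype.val '' ((upperGraph η χ (χ.val k)).connectedComponentMk ⟨g, hg⟩).supp,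
    _, ⟨k, rfl⟩, _, rfl⟩

theorem mem_component_iff {k g h : G} {hg : χ.val k ≤ χ.val g} :
    h ∈ (component η χ hg).1 ↔ JoinedAbove η χ (χ.val k) g h := by
  constructor
  · rintro ⟨h, hh, rfl⟩
    exact ⟨hg, h.2, (SimpleGraph.ConnectedComponent.exact hh).symm⟩
  · rintro ⟨_, hh, p⟩
    exact ⟨⟨h, hh⟩, SimpleGraph.ConnectedComponent.sound p.symm, rfl⟩

theorem exists_eq_component (C : CayleyTree η χ) :
    ∃ (k g : G) (hg : χ.val k ≤ χ.val g), C = component η χ hg := by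
  obtain ⟨_, _, ⟨k, rfl⟩, c, rfl⟩ := C
  induction c using SimpleGraph.ConnectedComponent.ind with
  | _ g => exact ⟨k, g, g.2, rfl⟩

theorem component_eq_of_connected (H : (upperGraph η χ 0).Connected) {k g : G}
    (hg : χ.val k ≤ χ.val g) : (component η χ hg).1 = {h | χ.val k ≤ χ.val h} :=
  Set.ext fun _ => mem_component_iff.trans
    ⟨fun p => p.symm.le_left, fun hh => joinedAbove_val_of_connected H hg hh⟩

theorem lam_component_of_connected (H : (upperGraph η χ 0).Connected) {k g : G}
    (hg : χ.val k ≤ χ.val g) : CayleyTree.lam η χ (component η χ hg) = χ.val k := by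
  rw [CayleyTree.lam, component_eq_of_connected H]
  exact IsLeast.csInf_eq ⟨⟨k, le_refl (χ.val k), rfl⟩, Set.forall_mem_image.2 fun _ => id⟩

theorem upperGraph_connected_of_isChain_univ
    (H : IsChain (· ≤ ·) (Set.univ : Set (CayleyTree η χ))) : (upperGraph η χ 0).Connected := by
  rw [upperGraph_connected_iff]
  intro g hg
  have h1 : χ.val (1 : G) ≤ χ.val (1 : G) := le_rfl
  have hg1 : χ.val 1 ≤ χ.val g := by simpa using hg
  rw [← χ.val_one]
  rcases H.total (Set.mem_univ (component η χ h1)) (Set.mem_univ (component η χ hg1)) with h | h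
  · exact mem_component_iff.1 (h (mem_component_iff.2 (.refl hg1)))
  · exact (mem_component_iff.1 (h (mem_component_iff.2 (.refl h1)))).symm

theorem isMeasuredLine_univ_of_connected (hχ : χ ≠ 0) (H : (upperGraph η χ 0).Connected) :
    IsMeasuredLine (CayleyTree.lam η χ) Set.univ where
  isChain C _ D _ _ := by
    obtain ⟨k, g, hg, rfl⟩ := exists_eq_component C
    obtain ⟨l, h, hh, rfl⟩ := exists_eq_component D
    change (component η χ hh).1 ⊆ (component η χ hg).1 ∨
      (component η χ hg).1 ⊆ (component η χ hh).1
    simp only [component_eq_of_connected H]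
    exact (le_total (χ.val k) (χ.val l)).imp (fun hkl _ => hkl.trans) (fun hlk _ => hlk.trans)
  ray_subset _ _ := Set.subset_univ _
  not_bddAbove := by
    refine not_bddAbove_iff.2 fun r => ?_
    obtain ⟨g, hg⟩ := Character.exists_lt_val hχ r
    exact ⟨χ.val g, ⟨component η χ le_rfl, trivial, lam_component_of_connected H le_rfl⟩, hg⟩

theorem isMeasuredLine_univ_iff (hχ : χ ≠ 0) :
    IsMeasuredLine (CayleyTree.lam η χ) Set.univ ↔ (upperGraph η χ 0).Connected :=
  ⟨fun H => upperGraph_connected_of_isChain_univ H.isChain, isMeasuredLine_univ_of_connected hχ⟩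

end CayleyTree

end CayleyTree

theorem isInvariantSet_of_smul_mem {G : Type u} [Group G] {T : Type u} [MulAction G T] {L : Set T}
    (H : ∀ g : G, ∀ a ∈ L, g • a ∈ L) : IsInvariantSet G L := fun g =>
  Set.Subset.antisymm (Set.image_subset_iff.2 (H g)) fun a ha => ⟨g⁻¹ • a, H g⁻¹ a ha, by simp⟩

section MeasuredTree

variable {T : Type u} [PartialOrder T] {lam : T → ℝ}

namespace IsMeasuredTree

theorem le_of_le_of_le (h : IsMeasuredTree lam) {a b c : T} (ha : a ≤ c) (hb : b ≤ c)
    (hab : lam a ≤ lam b) : a ≤ b := by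
  rcases (h.isChain_ray c).total ha hb with hle | hle
  · exact hle
  · exact (h.injOn_ray c ha hb (hab.antisymm (h.monotoneOn_ray c hb ha hle))).le

theorem exists_le_le (h : IsMeasuredTree lam) (a b : T) : ∃ c, c ≤ a ∧ c ≤ b := by
  obtain ⟨c, hc⟩ := h.bddBelow_of_finite {a, b} (Set.toFinite _)
  exact ⟨c, hc (by simp), hc (by simp)⟩

end IsMeasuredTree

variable {G : Type u} [Group G] {χ : Character G} [MulAction G T]

namespace IsMeasuredGTree

theorem smul_le_smul (h : IsMeasuredGTree G lam) (g : G) {a b : T} (hab : a ≤ b) :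
    g • a ≤ g • b := (h.morphism g).1 hab

theorem exists_le_smul (h : IsMeasuredGTree G lam) (hlam : HasAssociatedCharacter lam χ)
    {t : G} (ht : 0 ≤ χ.val t) : ∃ c : T, c ≤ t • c := by
  obtain ⟨b⟩ := h.nonempty
  obtain ⟨c, hc_smul, hc⟩ := h.exists_le_le (t • b) b
  exact ⟨c, h.le_of_le_of_le hc_smul (h.smul_le_smul t hc) (by linarith [hlam t c])⟩

theorem le_pow_smul (h : IsMeasuredGTree G lam) {t : G} {c : T} (hc : c ≤ t • c) (n : ℕ) :
    c ≤ t ^ n • c := by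
  induction n with
  | zero => simp
  | succ n ih =>
    rw [pow_succ', mul_smul]
    exact hc.trans (h.smul_le_smul t ih)

/- Given `g`, the ray below `c` meets the ray below `g • c`, and a high power `u` of `t` satisfies
`u⁻¹ • c ≤ g • c`. Hence `u` and `u * g` both move `c` upwards. -/
theorem isGeneratingSystem_val_setOf_le_smul (h : IsMeasuredGTree G lam)
    (hlam : HasAssociatedCharacter lam χ) {t : G} (ht : 0 < χ.val t) {c : T} (hc : c ≤ t • c) :
    IsGeneratingSystem (Subtype.val : {x : G | c ≤ x • c} → G) := by
  rw [IsGeneratingSystem, Subtype.range_coe, Subgroup.eq_top_iff']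
  intro g
  obtain ⟨d, hdc, hdg⟩ := h.exists_le_le c (g • c)
  obtain ⟨n, hn⟩ := Character.exists_lt_val_pow ht (lam c - lam d)
  have hu : c ≤ t ^ n • c := h.le_pow_smul hc n
  generalize t ^ n = u at hn hu
  have hinv : u⁻¹ • c ≤ c := by simpa using h.smul_le_smul u⁻¹ hu
  have hinv_d : u⁻¹ • c ≤ d := by
    refine h.le_of_le_of_le hinv hdc ?_
    have := hlam u⁻¹ c
    rw [Character.val_inv] at this
    linarith
  have hug : c ≤ (u * g) • c := by
    simpa [mul_smul] using h.smul_le_smul u (hinv_d.trans hdg)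
  rw [← inv_mul_cancel_left u g]
  exact mul_mem (inv_mem (Subgroup.subset_closure hu)) (Subgroup.subset_closure hug)

theorem le_smul_of_adj (h : IsMeasuredGTree G lam) (hlam : HasAssociatedCharacter lam χ) {c : T}
    {u v : {g : G | 0 ≤ χ.val g}}
    (huv : (upperGraph (Subtype.val : {x : G | c ≤ x • c} → G) χ 0).Adj u v)
    (hu : c ≤ u.1 • c) : c ≤ v.1 • c := by
  obtain ⟨-, _, ⟨x, rfl⟩, hx | hx⟩ := (SimpleGraph.mulCayley_adj' _ _ _).1 huv
  · change u.1 * x.1 = v.1 at hx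
    rw [← hx, mul_smul]
    exact hu.trans (h.smul_le_smul u.1 x.2)
  · change u.1 = v.1 * x.1 at hx
    have hvu : v.1 • c ≤ u.1 • c := by
      rw [hx, mul_smul]
      exact h.smul_le_smul v.1 x.2
    have hv : 0 ≤ χ.val v.1 := v.2
    exact h.le_of_le_of_le hu hvu (by linarith [hlam v.1 c])

theorem le_smul_of_connected (h : IsMeasuredGTree G lam) (hlam : HasAssociatedCharacter lam χ)
    {c : T} (H : (upperGraph (Subtype.val : {x : G | c ≤ x • c} → G) χ 0).Connected) {g : G}
    (hg : 0 ≤ χ.val g) : c ≤ g • c := by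
  have hpath := (SimpleGraph.reachable_iff_reflTransGen _ _).1
    (H.preconnected ⟨1, χ.val_one.ge⟩ ⟨g, hg⟩)
  exact hpath.trans_induction_on (motive := fun {u v} _ => c ≤ u.1 • c → c ≤ v.1 • c)
    (fun _ => id) (h.le_smul_of_adj hlam) (fun _ _ huv hvw => hvw ∘ huv) (one_smul G c).ge

theorem isMeasuredLine_lowerClosure_orbit (hχ : χ ≠ 0) (h : IsMeasuredGTree G lam)
    (hlam : HasAssociatedCharacter lam χ) {c : T} (hc : ∀ g : G, 0 ≤ χ.val g → c ≤ g • c) :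
    IsMeasuredLine lam (lowerClosure (MulAction.orbit G c) : Set T) where
  isChain := by
    have comparable (g k : G) (hgk : χ.val g ≤ χ.val k) : g • c ≤ k • c := by
      simpa [mul_smul] using h.smul_le_smul g (hc (g⁻¹ * k) (by simpa using hgk))
    rintro a ⟨_, ⟨g, rfl⟩, hg⟩ b ⟨_, ⟨k, rfl⟩, hk⟩ -
    rcases le_total (χ.val g) (χ.val k) with hgk | hkg
    · exact (h.isChain_ray _).total (hg.trans (comparable _ _ hgk)) hk
    · exact (h.isChain_ray _).total hg (hk.trans (comparable _ _ hkg))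
  ray_subset _ ha _ hb := (lowerClosure _).lower hb ha
  not_bddAbove := by
    refine not_bddAbove_iff.2 fun r => ?_
    obtain ⟨g, hg⟩ := Character.exists_lt_val hχ (r - lam c)
    exact ⟨lam (g • c), ⟨g • c, subset_lowerClosure ⟨g, rfl⟩, rfl⟩, by linarith [hlam g c]⟩

theorem isInvariantSet_lowerClosure_orbit (h : IsMeasuredGTree G lam) (c : T) :
    IsInvariantSet G (lowerClosure (MulAction.orbit G c) : Set T) := by
  apply isInvariantSet_of_smul_mem
  rintro g a ⟨b, hb, hab⟩
  exact ⟨g • b, MulAction.mem_orbit_of_mem_orbit g hb, h.smul_le_smul g hab⟩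

theorem exists_invariant_line (hχ : χ ≠ 0)
    (H : ∀ (X : Type u) (η : X → G), IsGeneratingSystem η → (upperGraph η χ 0).Connected)
    (h : IsMeasuredGTree G lam) (hlam : HasAssociatedCharacter lam χ) :
    ∃ L : Set T, IsMeasuredLine lam L ∧ IsInvariantSet G L := by
  obtain ⟨t, ht⟩ := Character.exists_val_pos hχ
  obtain ⟨c, htc⟩ := h.exists_le_smul hlam ht.le
  have hconn := H _ _ (h.isGeneratingSystem_val_setOf_le_smul hlam ht htc)
  exact ⟨_, h.isMeasuredLine_lowerClosure_orbit hχ hlam fun _ => h.le_smul_of_connected hlam hconn,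
    h.isInvariantSet_lowerClosure_orbit c⟩

end IsMeasuredGTree

end MeasuredTree

section Geodesics

open Set

section Piecewise

variable {T : Type u} {f g : ℝ → T} {a m : ℝ}

theorem domRestrict_Icc_piecewise_Iic :
    (Icc a m).domRestrict ((Iic m).piecewise f g) = (Icc a m).domRestrict f :=
  domRestrict_eq_domRestrict_iff.2 fun _ hv => piecewise_eq_of_mem _ _ _ hv.2

theorem eqOn_piecewise_Iic_Ici (h : f m = g m) : EqOn ((Iic m).piecewise f g) g (Ici m) := by
  intro v hv
  rcases (show m ≤ v from hv).eq_or_lt with rfl | hlt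
  · rw [piecewise_eq_of_mem _ _ _ (mem_Iic.2 le_rfl), h]
  · exact piecewise_eq_of_notMem _ _ _ (notMem_Iic.2 hlt)

end Piecewise

section PseudoMetricSpace

variable {T : Type u} [PseudoMetricSpace T] {f g : ℝ → T}

theorem isometry_domRestrict_iff {s : Set ℝ} :
    Isometry (s.domRestrict f) ↔ ∀ u ∈ s, ∀ v ∈ s, u ≤ v → dist (f u) (f v) = v - u := by
  have dist_of_le {u v : ℝ} (huv : u ≤ v) : dist u v = v - u := by
    rw [dist_comm, Real.dist_eq, abs_of_nonneg (sub_nonneg.2 huv)]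
  refine ⟨fun hf u hu v hv huv => ?_, fun hf => Isometry.of_dist_eq fun u v => ?_⟩
  · exact (hf.dist_eq ⟨u, hu⟩ ⟨v, hv⟩).trans (dist_of_le huv)
  · rcases le_total u v with huv | hvu
    · exact (hf u u.2 v v.2 huv).trans (dist_of_le huv).symm
    · rw [dist_comm, dist_comm u]
      exact (hf v v.2 u u.2 hvu).trans (dist_of_le hvu).symm

variable {a m c : ℝ}

theorem isometry_domRestrict_Icc_of_Icc_of_Icc (ham : a ≤ m) (hmc : m ≤ c)
    (h₁ : Isometry ((Icc a m).domRestrict f)) (h₂ : Isometry ((Icc m c).domRestrict f))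
    (h : dist (f a) (f c) = c - a) : Isometry ((Icc a c).domRestrict f) := by
  rw [isometry_domRestrict_iff] at h₁ h₂ ⊢
  rintro u ⟨hau, huc⟩ v ⟨hav, hvc⟩ huv
  rcases le_total v m with hvm | hmv
  · exact h₁ u ⟨hau, huv.trans hvm⟩ v ⟨hav, hvm⟩ huv
  rcases le_total m u with hmu | hum
  · exact h₂ u ⟨hmu, huc⟩ v ⟨hmv, hvc⟩ huv
  have hau' := h₁ a ⟨le_rfl, ham⟩ u ⟨hau, hum⟩ hau
  have hum' := h₁ u ⟨hau, hum⟩ m ⟨ham, le_rfl⟩ hum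
  have hmv' := h₂ m ⟨le_rfl, hmc⟩ v ⟨hmv, hvc⟩ hmv
  have hvc' := h₂ v ⟨hmv, hvc⟩ c ⟨hmc, le_rfl⟩ hvc
  linarith [dist_triangle (f u) (f m) (f v), dist_triangle4 (f a) (f u) (f v) (f c)]

theorem isometry_domRestrict_Ici_of_Icc_of_Ici (ham : a ≤ m)
    (h₁ : Isometry ((Icc a m).domRestrict f)) (h₂ : Isometry ((Ici m).domRestrict f))
    (h : ∀ c, m ≤ c → dist (f a) (f c) = c - a) : Isometry ((Ici a).domRestrict f) := by
  rw [isometry_domRestrict_iff] at h₂ ⊢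
  intro u hu v hv huv
  have hIcc : Isometry ((Icc m (max m v)).domRestrict f) :=
    isometry_domRestrict_iff.2 fun x hx y hy => h₂ x hx.1 y hy.1
  have hf := isometry_domRestrict_Icc_of_Icc_of_Icc ham (le_max_left m v) h₁ hIcc
    (h _ (le_max_left m v))
  have hvmax := le_max_right m v
  exact isometry_domRestrict_iff.1 hf u ⟨hu, huv.trans hvmax⟩ v ⟨hv, hvmax⟩ huv

theorem isometry_domRestrict_Icc_piecewise (ham : a ≤ m) (hmc : m ≤ c)
    (hf : Isometry ((Icc a m).domRestrict f)) (hg : Isometry ((Icc m c).domRestrict g))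
    (hfg : f m = g m) (h : dist (f a) (g c) = c - a) :
    Isometry ((Icc a c).domRestrict ((Iic m).piecewise f g)) := by
  have heq := eqOn_piecewise_Iic_Ici hfg
  refine isometry_domRestrict_Icc_of_Icc_of_Icc ham hmc ?_ ?_ ?_
  · rwa [domRestrict_Icc_piecewise_Iic]
  · rwa [domRestrict_eq_domRestrict_iff.2 (heq.mono Icc_subset_Ici_self)]
  · rwa [piecewise_eq_of_mem _ _ _ (mem_Iic.2 ham), heq (mem_Ici.2 hmc)]

theorem isometry_domRestrict_Ici_piecewise (ham : a ≤ m)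
    (hf : Isometry ((Icc a m).domRestrict f)) (hg : Isometry ((Ici m).domRestrict g))
    (hfg : f m = g m) (h : ∀ c, m ≤ c → dist (f a) (g c) = c - a) :
    Isometry ((Ici a).domRestrict ((Iic m).piecewise f g)) := by
  have heq := eqOn_piecewise_Iic_Ici hfg
  refine isometry_domRestrict_Ici_of_Icc_of_Ici ham (by rwa [domRestrict_Icc_piecewise_Iic]) ?_
    fun c hmc => ?_
  · rwa [domRestrict_eq_domRestrict_iff.2 heq]
  · rw [piecewise_eq_of_mem _ _ _ (mem_Iic.2 ham), heq (mem_Ici.2 hmc), h c hmc]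

end PseudoMetricSpace

variable {T : Type u} [MetricSpace T] {a b x y : T}

theorem IsGeodesicArc.dist_left {γ : Icc (0 : ℝ) (dist a b) → T} (hγ : IsGeodesicArc a b γ)
    (v : Icc (0 : ℝ) (dist a b)) : dist a (γ v) = v := by
  nth_rewrite 1 [← hγ.2.1]
  rw [hγ.1.dist_eq, Subtype.dist_eq, dist_comm, Real.dist_0_eq_abs, abs_of_nonneg v.2.1]

theorem IsGeodesicArc.dist_right {γ : Icc (0 : ℝ) (dist a b) → T} (hγ : IsGeodesicArc a b γ)
    (v : Icc (0 : ℝ) (dist a b)) : dist (γ v) b = dist a b - v := by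
  have hb : dist (γ v) (γ ⟨dist a b, dist_nonneg, le_rfl⟩) = dist a b - v := by
    rw [hγ.1.dist_eq, Subtype.dist_eq, dist_comm, Real.dist_eq, abs_of_nonneg (sub_nonneg.2 v.2.2)]
  rwa [hγ.2.2] at hb

theorem dist_add_dist_of_mem_geodesicSegment (hx : x ∈ geodesicSegment a b) :
    dist a x + dist x b = dist a b := by
  obtain ⟨γ, hγ, v, rfl⟩ := hx
  rw [hγ.dist_left, hγ.dist_right, add_sub_cancel]

/-- A geodesic metric space: any two points are joined by at least one geodesic arc. -/
def IsGeodesicSpace (T : Type u) [MetricSpace T] : Prop := ∀ a b : T, ∃ γ, IsGeodesicArc a b γ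

namespace IsGeodesicSpace

theorem exists_isometry_domRestrict (hT : IsGeodesicSpace T) (a b : T) (m : ℝ) :
    ∃ f : ℝ → T, f m = a ∧ f (m + dist a b) = b ∧
      Isometry ((Icc m (m + dist a b)).domRestrict f) := by
  obtain ⟨γ, hγ, hγa, hγb⟩ := hT a b
  have hd : 0 ≤ dist a b := dist_nonneg
  refine ⟨fun v => IccExtend hd γ (v - m), ?_, ?_,
    isometry_domRestrict_iff.2 fun u hu v hv huv => ?_⟩
  · change IccExtend hd γ (m - m) = a
    rwa [sub_self, IccExtend_left]
  · change IccExtend hd γ (m + dist a b - m) = b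
    rwa [add_sub_cancel_left, IccExtend_right]
  · have sub_mem {w : ℝ} (hw : w ∈ Icc m (m + dist a b)) : w - m ∈ Icc 0 (dist a b) :=
      ⟨sub_nonneg.2 hw.1, sub_le_iff_le_add'.2 hw.2⟩
    rw [IccExtend_of_mem hd γ (sub_mem hu), IccExtend_of_mem hd γ (sub_mem hv), hγ.dist_eq,
      Subtype.dist_eq, dist_comm, Real.dist_eq, sub_sub_sub_cancel_right,
      abs_of_nonneg (sub_nonneg.2 huv)]

theorem mem_geodesicSegment_iff (hT : IsGeodesicSpace T) :
    x ∈ geodesicSegment a b ↔ dist a x + dist x b = dist a b := by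
  refine ⟨dist_add_dist_of_mem_geodesicSegment, fun hx => ?_⟩
  obtain ⟨f, hfa, hfx, hf⟩ := hT.exists_isometry_domRestrict a x 0
  obtain ⟨g, hgx, hgb, hg⟩ := hT.exists_isometry_domRestrict x b (dist a x)
  rw [zero_add] at hfx hf
  rw [hx] at hgb hg
  have hax : 0 ≤ dist a x := dist_nonneg
  have hxb : dist a x ≤ dist a b := by linarith [dist_nonneg (x := x) (y := b)]
  have hk := isometry_domRestrict_Icc_piecewise hax hxb hf hg (hfx.trans hgx.symm)
    (by rw [hfa, hgb, sub_zero])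
  refine ⟨_, ⟨hk, ?_, ?_⟩, ⟨dist a x, hax, hxb⟩, ?_⟩
  · exact (piecewise_eq_of_mem _ _ _ (mem_Iic.2 hax)).trans hfa
  · exact (eqOn_piecewise_Iic_Ici (hfx.trans hgx.symm) hxb).trans hgb
  · exact (piecewise_eq_of_mem _ _ _ (mem_Iic.2 le_rfl)).trans hfx

theorem left_mem_geodesicSegment (hT : IsGeodesicSpace T) (a b : T) : a ∈ geodesicSegment a b :=
  hT.mem_geodesicSegment_iff.2 (by simp)

theorem right_mem_geodesicSegment (hT : IsGeodesicSpace T) (a b : T) : b ∈ geodesicSegment a b :=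
  hT.mem_geodesicSegment_iff.2 (by simp)

theorem geodesicSegment_subset (hT : IsGeodesicSpace T) (hx : x ∈ geodesicSegment a b) :
    geodesicSegment a x ⊆ geodesicSegment a b := fun y hy => by
  rw [hT.mem_geodesicSegment_iff] at hx hy ⊢
  linarith [dist_triangle a y b, dist_triangle y x b]

end IsGeodesicSpace

namespace IsRTree

theorem isGeodesicSpace (hT : IsRTree T) : IsGeodesicSpace T := fun a b =>
  (hT.existsUnique_arc a b).exists

theorem mem_geodesicSegment_iff (hT : IsRTree T) :
    x ∈ geodesicSegment a b ↔ dist a x + dist x b = dist a b :=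
  hT.isGeodesicSpace.mem_geodesicSegment_iff

theorem eq_of_mem_geodesicSegment (hT : IsRTree T) (hx : x ∈ geodesicSegment a b)
    (hy : y ∈ geodesicSegment a b) (hxy : dist a x = dist a y) : x = y := by
  obtain ⟨γ, hγ, u, rfl⟩ := hx
  obtain ⟨δ, hδ, v, rfl⟩ := hy
  obtain rfl := (hT.existsUnique_arc a b).unique hγ hδ
  rw [hγ.dist_left, hγ.dist_left] at hxy
  rw [Subtype.ext hxy]

end IsRTree

end Geodesics

section Rays

variable {T : Type u} [MetricSpace T]

namespace GeodesicRay

theorem ext {ρ σ : GeodesicRay T} (h : ∀ v, ρ.toFun v = σ.toFun v) : ρ = σ := by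
  cases ρ
  cases σ
  congr
  exact funext h

theorem dist_eq (ρ : GeodesicRay T) (s t : NNReal) :
    dist (ρ.toFun s) (ρ.toFun t) = |(s : ℝ) - t| := by
  rw [ρ.isometry.dist_eq, NNReal.dist_eq]

theorem dist_of_le (ρ : GeodesicRay T) {s t : NNReal} (hst : s ≤ t) :
    dist (ρ.toFun s) (ρ.toFun t) = t - s := by
  rw [ρ.dist_eq, abs_sub_comm, abs_of_nonneg (sub_nonneg.2 (NNReal.coe_le_coe.2 hst))]

theorem dist_toNNReal (ρ : GeodesicRay T) {u v : ℝ} (hu : 0 ≤ u) (huv : u ≤ v) :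
    dist (ρ.toFun u.toNNReal) (ρ.toFun v.toNNReal) = v - u := by
  rw [ρ.dist_of_le (Real.toNNReal_le_toNNReal huv), Real.coe_toNNReal _ hu,
    Real.coe_toNNReal _ (hu.trans huv)]

theorem dist_zero (ρ : GeodesicRay T) (v : NNReal) : dist (ρ.toFun 0) (ρ.toFun v) = v := by
  rw [ρ.dist_of_le zero_le, NNReal.coe_zero, sub_zero]

/-- The ray that is left when an initial piece of length `s` is removed. -/
def drop (ρ : GeodesicRay T) (s : NNReal) : GeodesicRay T where
  toFun v := ρ.toFun (s + v)
  isometry := Isometry.of_dist_eq fun u v => by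
    rw [ρ.dist_eq, NNReal.dist_eq, NNReal.coe_add, NNReal.coe_add, add_sub_add_left_eq_sub]

theorem mk_drop (ρ : GeodesicRay T) (s : NNReal) :
    (Quotient.mk _ (ρ.drop s) : TreeEnd T) = Quotient.mk _ ρ :=
  Quotient.sound ⟨0, s, fun v => by rw [zero_add]; rfl⟩

end GeodesicRay

namespace IsRTree

theorem ray_eq (hT : IsRTree T) {ρ σ : GeodesicRay T}
    (h : (Quotient.mk _ ρ : TreeEnd T) = Quotient.mk _ σ) (h₀ : ρ.toFun 0 = σ.toFun 0) :
    ρ = σ := by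
  obtain ⟨s, t, hst⟩ := Quotient.exact h
  have hs : ρ.toFun s = σ.toFun t := by simpa using hst 0
  obtain rfl : s = t := by
    rw [← NNReal.coe_inj, ← ρ.dist_zero s, ← σ.dist_zero t, h₀, hs]
  have mem_segment (τ : GeodesicRay T) {v : NNReal} (hv : v ≤ s) :
      τ.toFun v ∈ geodesicSegment (τ.toFun 0) (τ.toFun s) := by
    rw [hT.mem_geodesicSegment_iff, τ.dist_zero, τ.dist_zero, τ.dist_of_le hv, add_sub_cancel]
  refine GeodesicRay.ext fun v => ?_
  rcases le_total v s with hv | hv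
  · refine hT.eq_of_mem_geodesicSegment (mem_segment ρ hv) ?_ ?_
    · rw [h₀, hs]
      exact mem_segment σ hv
    · rw [ρ.dist_zero, h₀, σ.dist_zero]
  · obtain ⟨w, rfl⟩ := exists_add_of_le hv
    exact hst w

theorem exists_le_ray_eq (hT : IsRTree T) (σ : GeodesicRay T) {s t : NNReal} {x : T} (hst : s ≤ t)
    (hx : x ∈ geodesicSegment (σ.toFun s) (σ.toFun t)) : ∃ v, s ≤ v ∧ σ.toFun v = x := by
  have hdist := dist_add_dist_of_mem_geodesicSegment hx
  have hle : s + nndist (σ.toFun s) x ≤ t := by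
    rw [← NNReal.coe_le_coe, NNReal.coe_add, coe_nndist]
    linarith [dist_nonneg (x := x) (y := σ.toFun t), σ.dist_of_le hst]
  have hs := le_self_add (a := s) (b := nndist (σ.toFun s) x)
  refine ⟨_, hs, hT.eq_of_mem_geodesicSegment (hT.mem_geodesicSegment_iff.2 ?_) hx ?_⟩
  · rw [σ.dist_of_le hs, σ.dist_of_le hle, σ.dist_of_le hst]
    ring
  · rw [σ.dist_of_le hs, NNReal.coe_add, add_sub_cancel_left, coe_nndist]

theorem exists_isGreatest_ray_mem (hT : IsRTree T) (σ : GeodesicRay T) (a : T) :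
    ∃ s, IsGreatest {s | σ.toFun s ∈ geodesicSegment a (σ.toFun 0)} s := by
  have hσ := σ.isometry.continuous
  have hclosed : IsClosed {s | σ.toFun s ∈ geodesicSegment a (σ.toFun 0)} := by
    simp only [hT.mem_geodesicSegment_iff]
    exact isClosed_eq (by fun_prop) continuous_const
  refine IsCompact.exists_isGreatest ((isCompact_Icc (a := 0)
    (b := nndist a (σ.toFun 0))).of_isClosed_subset hclosed fun s hs => ⟨zero_le, ?_⟩)
    ⟨0, hT.isGeodesicSpace.right_mem_geodesicSegment _ _⟩
  have hdist := dist_add_dist_of_mem_geodesicSegment hs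
  rw [dist_comm _ (σ.toFun 0), σ.dist_zero] at hdist
  rw [← NNReal.coe_le_coe, coe_nndist]
  linarith [dist_nonneg (x := a) (y := σ.toFun s)]

theorem exists_dist_ray_add (hT : IsRTree T) (σ : GeodesicRay T) (a : T) :
    ∃ s, ∀ w, dist a (σ.toFun (s + w)) = dist a (σ.toFun s) + w := by
  obtain ⟨s, hs, hmax⟩ := hT.exists_isGreatest_ray_mem σ a
  refine ⟨s, fun w => ?_⟩
  have hle := le_self_add (a := s) (b := w)
  have hinter : geodesicSegment a (σ.toFun s) ∩ geodesicSegment (σ.toFun s) (σ.toFun (s + w)) =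
      {σ.toFun s} := by
    refine Set.Subset.antisymm ?_ (Set.singleton_subset_iff.2
      ⟨hT.isGeodesicSpace.right_mem_geodesicSegment _ _,
        hT.isGeodesicSpace.left_mem_geodesicSegment _ _⟩)
    rintro x ⟨hax, hx⟩
    obtain ⟨v, hsv, rfl⟩ := hT.exists_le_ray_eq σ hle hx
    rw [Set.mem_singleton_iff,
      le_antisymm (hmax (hT.isGeodesicSpace.geodesicSegment_subset hs hax)) hsv]
  have hmem : σ.toFun s ∈ geodesicSegment a (σ.toFun (s + w)) := by
    rw [← hT.union_segment _ _ _ hinter]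
    exact Or.inl (hT.isGeodesicSpace.right_mem_geodesicSegment _ _)
  rw [← dist_add_dist_of_mem_geodesicSegment hmem, σ.dist_of_le hle, NNReal.coe_add,
    add_sub_cancel_left]

/- The ray from `a` runs first to the last point of `σ` that lies on `[a, σ 0]`, then along `σ`. -/
theorem exists_ray_equiv (hT : IsRTree T) (σ : GeodesicRay T) (a : T) :
    ∃ ρ : GeodesicRay T, (Quotient.mk _ ρ : TreeEnd T) = Quotient.mk _ σ ∧ ρ.toFun 0 = a := by
  obtain ⟨s, hs⟩ := hT.exists_dist_ray_add σ a
  obtain ⟨f, hfa, hfs, hf⟩ := hT.isGeodesicSpace.exists_isometry_domRestrict a (σ.toFun s) 0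
  rw [zero_add] at hfs hf
  have hD : 0 ≤ dist a (σ.toFun s) := dist_nonneg
  generalize dist a (σ.toFun s) = D at hs hfs hf hD
  let g : ℝ → T := fun v => (σ.drop s).toFun (v - D).toNNReal
  have hg : Isometry ((Set.Ici D).domRestrict g) := by
    refine isometry_domRestrict_iff.2 fun u hu v _ huv => ?_
    rw [(σ.drop s).dist_toNNReal (sub_nonneg.2 hu) (sub_le_sub_right huv D),
      sub_sub_sub_cancel_right]
  have hfg : f D = g D := by simp [g, GeodesicRay.drop, hfs]
  have hk := isometry_domRestrict_Ici_piecewise hD hf hg hfg fun c hc => by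
    change dist (f 0) (σ.toFun _) = _
    rw [hfa, hs, Real.coe_toNNReal _ (sub_nonneg.2 hc)]
    ring
  refine ⟨⟨fun v => (Set.Iic D).piecewise f g v, hk⟩, Quotient.sound ⟨⟨D, hD⟩, s, fun v => ?_⟩, ?_⟩
  · change (Set.Iic D).piecewise f g (D + v) = _
    refine (eqOn_piecewise_Iic_Ici hfg (Set.mem_Ici.2 (le_add_of_nonneg_right v.2))).trans ?_
    simp [g, GeodesicRay.drop]
  · change (Set.Iic D).piecewise f g 0 = a
    rwa [Set.piecewise_eq_of_mem _ _ _ (Set.mem_Iic.2 hD)]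

end IsRTree

end Rays

section EndOrder

variable {T : Type u} [MetricSpace T]

namespace IsRTree

theorem exists_ray (hT : IsRTree T) (e : TreeEnd T) (a : T) :
    ∃ ρ : GeodesicRay T, (Quotient.mk _ ρ : TreeEnd T) = e ∧ ρ.toFun 0 = a :=
  Quotient.inductionOn e fun σ => hT.exists_ray_equiv σ a

variable (hT : IsRTree T) (e : TreeEnd T)

/-- The geodesic ray with end point `a` that represents the end `e`. -/
noncomputable def rayAt (a : T) : GeodesicRay T := (hT.exists_ray e a).choose

theorem mk_rayAt (a : T) : (Quotient.mk _ (hT.rayAt e a) : TreeEnd T) = e :=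
  (hT.exists_ray e a).choose_spec.1

@[simp] theorem rayAt_zero (a : T) : (hT.rayAt e a).toFun 0 = a :=
  (hT.exists_ray e a).choose_spec.2

variable {e}

theorem rayAt_eq {ρ : GeodesicRay T} {a : T} (h : (Quotient.mk _ ρ : TreeEnd T) = e)
    (ha : ρ.toFun 0 = a) : hT.rayAt e a = ρ :=
  hT.ray_eq ((hT.mk_rayAt e a).trans h.symm) ((hT.rayAt_zero e a).trans ha.symm)

variable (e)

theorem rayAt_rayAt (a : T) (v w : NNReal) :
    (hT.rayAt e ((hT.rayAt e a).toFun v)).toFun w = (hT.rayAt e a).toFun (v + w) := by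
  rw [hT.rayAt_eq (((hT.rayAt e a).mk_drop v).trans (hT.mk_rayAt e a))
    (congrArg (hT.rayAt e a).toFun (add_zero v))]
  rfl

theorem mem_descendingRay_iff {a x : T} :
    x ∈ descendingRay e a ↔ ∃ v, (hT.rayAt e a).toFun v = x := by
  constructor
  · rintro ⟨ρ, hρ, ha, v, rfl⟩
    exact ⟨v, by rw [hT.rayAt_eq hρ ha]⟩
  · rintro ⟨v, rfl⟩
    exact ⟨_, hT.mk_rayAt e a, hT.rayAt_zero e a, v, rfl⟩

theorem endLE_iff {a x : T} : endLE e x a ↔ ∃ v, (hT.rayAt e a).toFun v = x := by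
  constructor
  · exact fun h => (hT.mem_descendingRay_iff e).1 (h ((hT.mem_descendingRay_iff e).2 ⟨0, by simp⟩))
  · rintro ⟨v, rfl⟩ y hy
    obtain ⟨w, rfl⟩ := (hT.mem_descendingRay_iff e).1 hy
    exact (hT.mem_descendingRay_iff e).2 ⟨v + w, (hT.rayAt_rayAt e a v w).symm⟩

theorem endLE_rayAt (a : T) (v : NNReal) : endLE e ((hT.rayAt e a).toFun v) a :=
  (hT.endLE_iff e).2 ⟨v, rfl⟩

theorem exists_rayAt_eq_rayAt (a b : T) :
    ∃ s t, (hT.rayAt e a).toFun s = (hT.rayAt e b).toFun t := by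
  obtain ⟨s, t, h⟩ := Quotient.exact ((hT.mk_rayAt e a).trans (hT.mk_rayAt e b).symm)
  exact ⟨s, t, by simpa using h 0⟩

theorem sub_eq_sub_of_rayAt_eq {a b : T} {s t s' t' : NNReal}
    (h : (hT.rayAt e a).toFun s = (hT.rayAt e b).toFun t)
    (h' : (hT.rayAt e a).toFun s' = (hT.rayAt e b).toFun t') :
    (s : ℝ) - t = s' - t' := by
  wlog hs : s ≤ s' generalizing s t s' t'
  · exact (this h' h (le_of_not_ge hs)).symm
  obtain ⟨w, rfl⟩ := exists_add_of_le hs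
  rw [← hT.rayAt_rayAt, h, hT.rayAt_rayAt] at h'
  rw [← (hT.rayAt e b).isometry.injective h', NNReal.coe_add, NNReal.coe_add,
    add_sub_add_right_eq_sub]

theorem endMeasure_eq {b x : T} {s t : NNReal}
    (h : (hT.rayAt e x).toFun s = (hT.rayAt e b).toFun t) : endMeasure e b x = s - t := by
  have hex : ∃ c, endLE e c x ∧ endLE e c b := ⟨_, hT.endLE_rayAt e x s, h ▸ hT.endLE_rayAt e b t⟩
  have hspec := Classical.epsilon_spec_aux ⟨b⟩ _ hex
  rw [endMeasure]
  generalize @Classical.epsilon T ⟨b⟩ (fun c => endLE e c x ∧ endLE e c b) = c at hspec ⊢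
  obtain ⟨s', rfl⟩ := (hT.endLE_iff e).1 hspec.1
  obtain ⟨t', ht'⟩ := (hT.endLE_iff e).1 hspec.2
  have hs := (hT.rayAt e x).dist_zero s'
  have ht := (hT.rayAt e b).dist_zero t'
  rw [rayAt_zero, dist_comm] at hs ht
  rw [hT.sub_eq_sub_of_rayAt_eq e h ht'.symm, hs, ← ht, ht']

theorem endMeasure_rayAt (b x : T) (v : NNReal) :
    endMeasure e b ((hT.rayAt e x).toFun v) = endMeasure e b x - v := by
  obtain ⟨s, t, h⟩ := hT.exists_rayAt_eq_rayAt e x b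
  have h' : (hT.rayAt e ((hT.rayAt e x).toFun v)).toFun s = (hT.rayAt e b).toFun (t + v) := by
    rw [rayAt_rayAt, add_comm, ← rayAt_rayAt, h, rayAt_rayAt]
  rw [hT.endMeasure_eq e h, hT.endMeasure_eq e h', NNReal.coe_add, sub_add_eq_sub_sub]

include hT in
theorem dist_eq_of_endLE (b : T) {a x : T} (h : endLE e x a) :
    dist x a = endMeasure e b a - endMeasure e b x := by
  obtain ⟨v, rfl⟩ := (hT.endLE_iff e).1 h
  rw [endMeasure_rayAt, sub_sub_cancel, ← (hT.rayAt e a).dist_zero v, rayAt_zero, dist_comm]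

include hT in
theorem endLE_or_endLE {a x y : T} (hx : endLE e x a) (hy : endLE e y a) :
    endLE e x y ∨ endLE e y x := by
  obtain ⟨v, rfl⟩ := (hT.endLE_iff e).1 hx
  obtain ⟨w, rfl⟩ := (hT.endLE_iff e).1 hy
  rcases le_total v w with h | h
  · obtain ⟨z, rfl⟩ := exists_add_of_le h
    exact Or.inr ((hT.endLE_iff e).2 ⟨z, hT.rayAt_rayAt e a v z⟩)
  · obtain ⟨z, rfl⟩ := exists_add_of_le h
    exact Or.inl ((hT.endLE_iff e).2 ⟨z, hT.rayAt_rayAt e a w z⟩)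

/-- The order of an `ℝ`-tree that is attached to the end `e`; the points below `a` are those of the
ray from `a` to `e`. -/
abbrev endOrder : PartialOrder T where
  le := endLE e
  le_refl _ := Set.Subset.rfl
  le_trans _ _ _ h h' := Set.Subset.trans h h'
  le_antisymm x a h h' := by
    have hxa := hT.dist_eq_of_endLE e x h
    have hax := hT.dist_eq_of_endLE e x h'
    rw [dist_comm] at hax
    exact dist_eq_zero.1 (by linarith)

theorem isCodirectedOrder_endOrder :
    letI := hT.endOrder e
    IsCodirectedOrder T := by
  let _ := hT.endOrder e
  refine ⟨fun x y => ?_⟩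
  obtain ⟨s, t, h⟩ := hT.exists_rayAt_eq_rayAt e x y
  exact ⟨_, hT.endLE_rayAt e x s, h ▸ hT.endLE_rayAt e y t⟩

theorem isMeasuredTree_endMeasure (b : T) :
    letI := hT.endOrder e
    IsMeasuredTree (endMeasure e b) :=
  letI := hT.endOrder e
  { nonempty := ⟨b⟩
    bddBelow_of_finite := by
      have := hT.isCodirectedOrder_endOrder e
      have : Nonempty T := ⟨b⟩
      exact fun s hs => hs.bddBelow
    isChain_ray := fun _ _ hx _ hy _ => hT.endLE_or_endLE e hx hy
    injOn_ray := by
      intro a x hx y hy hxy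
      rcases hT.endLE_or_endLE e hx hy with h | h
      · exact dist_eq_zero.1 (by rw [hT.dist_eq_of_endLE e b h, hxy, sub_self])
      · exact (dist_eq_zero.1 (by rw [hT.dist_eq_of_endLE e b h, hxy, sub_self])).symm
    monotoneOn_ray := fun _ _ _ _ _ h =>
      sub_nonneg.1 (dist_nonneg.trans_eq (hT.dist_eq_of_endLE e b h))
    not_bddBelow_ray := by
      refine fun a => not_bddBelow_iff.2 fun r => ?_
      refine ⟨_, ⟨_, hT.endLE_rayAt e a (endMeasure e b a - r + 1).toNNReal, rfl⟩, ?_⟩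
      rw [endMeasure_rayAt]
      linarith [Real.le_coe_toNNReal (endMeasure e b a - r + 1)] }

section Line

variable {b : T} {L : Set T}

theorem dist_eq_of_mem_isMeasuredLine
    (hL : letI := hT.endOrder e; IsMeasuredLine (endMeasure e b) L) {x y : T} (hx : x ∈ L)
    (hy : y ∈ L) : dist x y = |endMeasure e b x - endMeasure e b y| := by
  let _ := hT.endOrder e
  rcases hL.isChain.total hx hy with h | h
  · rw [abs_sub_comm, ← hT.dist_eq_of_endLE e b h, abs_of_nonneg dist_nonneg]
  · rw [← hT.dist_eq_of_endLE e b h, abs_of_nonneg dist_nonneg, dist_comm]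

theorem exists_mem_isMeasuredLine_endMeasure_eq
    (hL : letI := hT.endOrder e; IsMeasuredLine (endMeasure e b) L) (r : ℝ) :
    ∃ x ∈ L, endMeasure e b x = r := by
  let _ := hT.endOrder e
  obtain ⟨_, ⟨a, ha, rfl⟩, hr⟩ := not_bddAbove_iff.1 hL.not_bddAbove r
  refine ⟨_, hL.ray_subset a ha (hT.endLE_rayAt e a (endMeasure e b a - r).toNNReal), ?_⟩
  rw [endMeasure_rayAt, Real.coe_toNNReal _ (sub_nonneg.2 hr.le), sub_sub_cancel]

theorem isGeodesicLine_of_isMeasuredLine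
    (hL : letI := hT.endOrder e; IsMeasuredLine (endMeasure e b) L) : IsGeodesicLine L := by
  choose φ hφL hφ using hT.exists_mem_isMeasuredLine_endMeasure_eq e hL
  refine ⟨φ, Isometry.of_dist_eq fun r s => ?_, Set.Subset.antisymm ?_ fun x hx => ?_⟩
  · rw [hT.dist_eq_of_mem_isMeasuredLine e hL (hφL r) (hφL s), hφ, hφ, Real.dist_eq]
  · exact Set.range_subset_iff.2 hφL
  · refine ⟨endMeasure e b x, dist_eq_zero.1 ?_⟩
    rw [hT.dist_eq_of_mem_isMeasuredLine e hL (hφL _) hx, hφ, sub_self, abs_zero]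

end Line

variable {G : Type u} [Group G] [MulAction G T] [IsIsometricSMul G T] {e}

theorem smul_rayAt (he : FixesEnd G e) (g : G) (a : T) (v : NNReal) :
    g • (hT.rayAt e a).toFun v = (hT.rayAt e (g • a)).toFun v := by
  have h : (Quotient.mk _ ((hT.rayAt e a).translate g) : TreeEnd T) = e :=
    (congrArg (TreeEnd.translate g) (hT.mk_rayAt e a)).trans (he g)
  rw [hT.rayAt_eq h (congrArg (g • ·) (hT.rayAt_zero e a))]
  rfl

theorem isMeasuredGTree_endMeasure (he : FixesEnd G e) (b : T) {χ : Character G}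
    (h : HasAssociatedCharacter (endMeasure e b) χ) :
    letI := hT.endOrder e
    IsMeasuredGTree G (endMeasure e b) := by
  let _ := hT.endOrder e
  refine ⟨hT.isMeasuredTree_endMeasure e b, fun g => ⟨?_, χ.val g, fun a => by linarith [h g a]⟩⟩
  intro x a hxa
  obtain ⟨v, rfl⟩ := (hT.endLE_iff e).1 hxa
  exact (hT.endLE_iff e).2 ⟨v, (hT.smul_rayAt he g a v).symm⟩

end IsRTree

end EndOrder

section FourPoint

/-- Gromov's four-point condition, which characterizes the metric subspaces of `ℝ`-trees: of the
three sums of the distances between complementary pairs of points, the two largest are equal. -/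
def FourPointCondition (T : Type u) [PseudoMetricSpace T] : Prop :=
  ∀ x y p q : T, dist x y + dist p q ≤ max (dist x p + dist y q) (dist x q + dist y p)

namespace FourPointCondition

variable {T : Type u} [MetricSpace T] {a b c x y : T}

theorem eq_of_dist_eq (hT : FourPointCondition T) (hx : dist a x + dist x b = dist a b)
    (hy : dist a y + dist y b = dist a b) (hxy : dist a x = dist a y) : x = y := by
  have h := hT x y a b
  rw [dist_comm x a, dist_comm y a, max_eq_left (by linarith)] at h
  exact dist_le_zero.1 (by linarith)

/- The point of `[a, b]` at distance `(a | c)_b` from `b`, a Gromov product, lies on `[b, c]`. -/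
theorem dist_add_dist_eq_of_inter_eq (hT : FourPointCondition T) (hG : IsGeodesicSpace T)
    (h : geodesicSegment a b ∩ geodesicSegment b c = {b}) :
    dist a b + dist b c = dist a c := by
  obtain ⟨γ, hγ⟩ := hG a b
  have hv : (dist a b + dist a c - dist b c) / 2 ∈ Set.Icc 0 (dist a b) := by
    have hbac := dist_triangle b a c
    have habc := dist_triangle a b c
    have hacb := dist_triangle a c b
    rw [dist_comm b a] at hbac
    rw [dist_comm c b] at hacb
    constructor <;> linarith
  have hax := hγ.dist_left ⟨_, hv⟩
  have hxb := hγ.dist_right ⟨_, hv⟩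
  generalize γ ⟨_, hv⟩ = x at hax hxb
  dsimp only at hax hxb
  have hxab : x ∈ geodesicSegment a b := hG.mem_geodesicSegment_iff.2 (by linarith)
  have hxbc : x ∈ geodesicSegment b c := by
    have hfour := hT x c a b
    rw [dist_comm x a, dist_comm c b, dist_comm c a, max_eq_left (by linarith)] at hfour
    refine hG.mem_geodesicSegment_iff.2 (le_antisymm ?_ (dist_triangle b x c))
    rw [dist_comm b x]
    linarith
  obtain rfl : x = b := h.subset ⟨hxab, hxbc⟩
  rw [dist_self] at hxb
  linarith

theorem union_geodesicSegment (hT : FourPointCondition T) (hG : IsGeodesicSpace T)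
    (h : dist a b + dist b c = dist a c) :
    geodesicSegment a b ∪ geodesicSegment b c = geodesicSegment a c := by
  ext x
  simp only [Set.mem_union, hG.mem_geodesicSegment_iff]
  have haxc := dist_triangle a x c
  refine ⟨?_, fun hx => ?_⟩
  · rintro (hx | hx)
    · linarith [dist_triangle x b c]
    · linarith [dist_triangle a b x]
  · have hfour := hT x b a c
    rw [dist_comm x a, dist_comm b a] at hfour
    rcases le_max_iff.1 hfour with hle | hle
    · refine Or.inr (le_antisymm ?_ (dist_triangle b x c))
      rw [dist_comm b x]
      linarith
    · exact Or.inl (le_antisymm (by linarith) (dist_triangle a x b))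

theorem isRTree (hT : FourPointCondition T) (hG : IsGeodesicSpace T) : IsRTree T where
  existsUnique_arc a b := by
    obtain ⟨γ, hγ⟩ := hG a b
    refine ⟨γ, hγ, fun δ hδ => funext fun v => ?_⟩
    refine hT.eq_of_dist_eq (a := a) (b := b) ?_ ?_ ?_
    · rw [hδ.dist_left, hδ.dist_right, add_sub_cancel]
    · rw [hγ.dist_left, hγ.dist_right, add_sub_cancel]
    · rw [hδ.dist_left, hγ.dist_left]
  union_segment _ _ _ h := hT.union_geodesicSegment hG (hT.dist_add_dist_eq_of_inter_eq hG h)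

end FourPointCondition

end FourPoint

theorem IsGeodesicLine.dist_add_dist_eq {T : Type u} [MetricSpace T] {L : Set T} {x y z : T}
    (hL : IsGeodesicLine L) (hx : x ∈ L) (hy : y ∈ L) (hz : z ∈ L) :
    dist x y + dist y z = dist x z ∨ dist x z + dist z y = dist x y ∨
      dist y x + dist x z = dist y z := by
  obtain ⟨φ, hφ, rfl⟩ := hL
  obtain ⟨u, rfl⟩ := hx
  obtain ⟨v, rfl⟩ := hy
  obtain ⟨w, rfl⟩ := hz
  simp only [hφ.dist_eq, Real.dist_eq]
  grind

section TreeKernel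

/-- A symmetric kernel on `A` that satisfies the ultrametric inequality. One attaches to each
element of `A` a ray that descends from it, and `meet a b` is the level at which the rays of `a` and
`b` merge; in particular the ray of `a` starts at the level `meet a a`. -/
structure TreeKernel (A : Type u) where
  meet : A → A → ℝ
  symm : ∀ a b, meet a b = meet b a
  ultra : ∀ a b c, min (meet a b) (meet b c) ≤ meet a c

namespace TreeKernel

variable {A : Type u} {K : TreeKernel A}

variable (K) in
/-- The points of the rays descending from the elements of `A`, before the rays are merged: the
point of level `level` on the ray of `base`. -/
@[ext] structure Point where
  base : A
  level : ℝ
  le : level ≤ K.meet base base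

namespace Point

/-- The level at which the rays descending from two points merge. -/
def meet (p q : K.Point) : ℝ := min (min p.level q.level) (K.meet p.base q.base)

theorem meet_comm (p q : K.Point) : meet p q = meet q p := by
  rw [meet, meet, min_comm p.level, K.symm]

theorem meet_self (p : K.Point) : meet p p = p.level := by
  rw [meet, min_self, min_eq_left p.le]

theorem meet_le_left (p q : K.Point) : meet p q ≤ p.level :=
  (min_le_left _ _).trans (min_le_left _ _)

theorem meet_le_right (p q : K.Point) : meet p q ≤ q.level :=
  (min_le_left _ _).trans (min_le_right _ _)

theorem meet_le_meet_base (p q : K.Point) : meet p q ≤ K.meet p.base q.base := min_le_right _ _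

theorem min_meet_meet_le (p q r : K.Point) : min (meet p q) (meet q r) ≤ meet p r :=
  le_min (le_min (min_le_of_left_le (meet_le_left p q)) (min_le_of_right_le (meet_le_right q r)))
    ((min_le_min (meet_le_meet_base p q) (meet_le_meet_base q r)).trans (K.ultra _ _ _))

/-- Two points are at the distance of the path that descends from one of them to the level where
the rays merge, and then ascends to the other one. -/
noncomputable instance : PseudoMetricSpace K.Point where
  dist p q := p.level + q.level - 2 * meet p q
  dist_self p := by rw [meet_self, two_mul, sub_self]
  dist_comm p q := by rw [meet_comm, add_comm]
  dist_triangle p q r := by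
    rcases min_le_iff.1 (min_meet_meet_le p q r) with h | h
    · linarith [meet_le_left q r]
    · linarith [meet_le_right p q]

theorem dist_def (p q : K.Point) : dist p q = p.level + q.level - 2 * meet p q := rfl

theorem min_meet_add_meet_le (x y p q : K.Point) :
    min (meet x p + meet y q) (meet x q + meet y p) ≤ meet x y + meet p q := by
  have hxpy := min_meet_meet_le x p y
  have hxqy := min_meet_meet_le x q y
  have hpxq := min_meet_meet_le p x q
  have hpyq := min_meet_meet_le p y q
  rw [meet_comm p y] at hxpy hpyq
  rw [meet_comm q y] at hxqy
  rw [meet_comm p x] at hpxq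
  grind

theorem fourPointCondition : FourPointCondition K.Point := fun x y p q => by
  simp only [dist_def, le_max_iff]
  rcases min_le_iff.1 (min_meet_add_meet_le x y p q) with h | h
  · exact Or.inl (by linarith)
  · exact Or.inr (by linarith)

/-- The point at distance `v` below `p`. -/
@[simps] def down (p : K.Point) (v : NNReal) : K.Point where
  base := p.base
  level := p.level - v
  le := (sub_le_self _ v.2).trans p.le

theorem down_zero (p : K.Point) : p.down 0 = p := by ext <;> simp

theorem meet_down_down (p q : K.Point) (u v : NNReal) :
    meet (p.down u) (q.down v) = min (meet p q) (min (p.level - u) (q.level - v)) := by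
  have hu := u.coe_nonneg
  have hv := v.coe_nonneg
  simp only [meet, down_base, down_level]
  grind

theorem dist_down_down (p : K.Point) (u v : NNReal) :
    dist (p.down u) (p.down v) = |(u : ℝ) - v| := by
  have hu := u.coe_nonneg
  simp only [dist_def, meet_down_down, meet_self, down_level]
  grind

/-- The length of the descent from `p` to the level at which the rays of `p` and `q` merge. -/
def descent (p q : K.Point) : NNReal := ⟨p.level - meet p q, sub_nonneg.2 (meet_le_left p q)⟩

theorem coe_descent (p q : K.Point) : (descent p q : ℝ) = p.level - meet p q := rfl

theorem dist_eq_descent_add_descent (p q : K.Point) :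
    dist p q = descent p q + descent q p := by
  rw [dist_def, coe_descent, coe_descent, meet_comm q p]
  ring

theorem dist_down_descent_add (p q : K.Point) (v : NNReal) :
    dist (p.down (descent p q + v)) (q.down (descent q p + v)) = 0 := by
  have hv := v.coe_nonneg
  simp only [dist_def, meet_down_down, down_level, NNReal.coe_add, coe_descent, meet_comm q p]
  grind

end Point

variable (K) in
/-- The `ℝ`-tree of an ultrametric kernel: the points of the descending rays, points at distance `0`
being identified. -/
abbrev Tree : Type u := SeparationQuotient K.Point

namespace Point

/-- The ray of the tree that descends from a point. -/
noncomputable def ray (p : K.Point) : GeodesicRay K.Tree where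
  toFun v := SeparationQuotient.mk (p.down v)
  isometry := Isometry.of_dist_eq fun u v => by
    rw [SeparationQuotient.dist_mk, dist_down_down, NNReal.dist_eq]

theorem ray_zero (p : K.Point) : p.ray.toFun 0 = SeparationQuotient.mk p :=
  congrArg SeparationQuotient.mk p.down_zero

theorem ray_descent_add (p q : K.Point) (v : NNReal) :
    p.ray.toFun (descent p q + v) = q.ray.toFun (descent q p + v) :=
  dist_eq_zero.1 (dist_down_descent_add p q v)

theorem ray_descent (p q : K.Point) :
    p.ray.toFun (descent p q) = q.ray.toFun (descent q p) := by
  simpa only [add_zero] using ray_descent_add p q 0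

end Point

theorem isGeodesicSpace : IsGeodesicSpace K.Tree := fun a b => by
  obtain ⟨p, rfl⟩ := SeparationQuotient.surjective_mk a
  obtain ⟨q, rfl⟩ := SeparationQuotient.surjective_mk b
  have hd : dist p q = p.descent q + q.descent p := p.dist_eq_descent_add_descent q
  have hm : (p.descent q : ℝ) ≤ dist p q := hd ▸ le_add_of_nonneg_right (q.descent p).2
  let f : ℝ → K.Tree := fun v => p.ray.toFun v.toNNReal
  let g : ℝ → K.Tree := fun v => q.ray.toFun (dist p q - v).toNNReal
  have hf : Isometry ((Set.Icc 0 (p.descent q : ℝ)).domRestrict f) :=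
    isometry_domRestrict_iff.2 fun u hu v _ huv => p.ray.dist_toNNReal hu.1 huv
  have hg : Isometry ((Set.Icc (p.descent q : ℝ) (dist p q)).domRestrict g) := by
    refine isometry_domRestrict_iff.2 fun u _ v hv huv => ?_
    rw [dist_comm, q.ray.dist_toNNReal (sub_nonneg.2 hv.2) (sub_le_sub_left huv _),
      sub_sub_sub_cancel_left]
  have hfg : f (p.descent q) = g (p.descent q) := by
    simp only [f, g, hd, add_sub_cancel_left, Real.toNNReal_coe, p.ray_descent q]
  have hf₀ : f 0 = SeparationQuotient.mk p := by simp only [f, Real.toNNReal_zero, p.ray_zero]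
  have hg₁ : g (dist p q) = SeparationQuotient.mk q := by
    simp only [g, sub_self, Real.toNNReal_zero, q.ray_zero]
  refine ⟨_, isometry_domRestrict_Icc_piecewise (p.descent q).2 hm hf hg hfg ?_, ?_, ?_⟩
  · rw [SeparationQuotient.dist_mk, hf₀, hg₁, SeparationQuotient.dist_mk, sub_zero]
  · exact (Set.piecewise_eq_of_mem _ _ _ (Set.mem_Iic.2 (p.descent q).2)).trans hf₀
  · exact (eqOn_piecewise_Iic_Ici hfg hm).trans hg₁

variable (K) in
theorem isRTree : IsRTree K.Tree := by
  refine FourPointCondition.isRTree (fun x y p q => ?_) isGeodesicSpace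
  obtain ⟨x, rfl⟩ := SeparationQuotient.surjective_mk x
  obtain ⟨y, rfl⟩ := SeparationQuotient.surjective_mk y
  obtain ⟨p, rfl⟩ := SeparationQuotient.surjective_mk p
  obtain ⟨q, rfl⟩ := SeparationQuotient.surjective_mk q
  exact Point.fourPointCondition x y p q

namespace Point

/-- The end of the tree towards which the ray of a point descends; it does not depend on the
point. -/
noncomputable def toEnd (p : K.Point) : TreeEnd K.Tree := Quotient.mk _ p.ray

theorem toEnd_eq (p q : K.Point) : p.toEnd = q.toEnd :=
  Quotient.sound ⟨descent p q, descent q p, ray_descent_add p q⟩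

theorem rayAt_toEnd (o p : K.Point) : K.isRTree.rayAt o.toEnd (SeparationQuotient.mk p) = p.ray :=
  K.isRTree.rayAt_eq (toEnd_eq p o) p.ray_zero

theorem endMeasure_toEnd (o b x : K.Point) :
    endMeasure o.toEnd (SeparationQuotient.mk b) (SeparationQuotient.mk x) =
      x.level - b.level := by
  rw [K.isRTree.endMeasure_eq o.toEnd (s := descent x b) (t := descent b x), coe_descent,
    coe_descent, meet_comm b x, sub_sub_sub_cancel_right]
  rw [rayAt_toEnd, rayAt_toEnd, ray_descent]

/- A point `w` of the line below the level `meet p q` lies below both `p` and `q`, so it is not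
between them. -/
theorem meet_eq_level_of_mem_isGeodesicLine {L : Set K.Tree} (hL : IsGeodesicLine L)
    (hlow : ∀ r : ℝ, ∃ w : K.Point, w.level < r ∧ SeparationQuotient.mk w ∈ L) {p q : K.Point}
    (hp : SeparationQuotient.mk p ∈ L) (hq : SeparationQuotient.mk q ∈ L)
    (hpq : p.level ≤ q.level) : meet p q = p.level := by
  obtain ⟨w, hw, hwL⟩ := hlow (meet p q)
  have hpw := min_meet_meet_le p q w
  have hqw := min_meet_meet_le q p w
  rw [meet_comm q p] at hqw
  have hpw_le := meet_le_right p w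
  have hqw_le := meet_le_right q w
  rw [min_eq_right (by linarith)] at hpw hqw
  refine le_antisymm (meet_le_left p q) ?_
  have hbetween := hL.dist_add_dist_eq hp hq hwL
  simp only [SeparationQuotient.dist_mk, dist_def, meet_comm w q, meet_comm q p] at hbetween
  rcases hbetween with h | h | h <;> linarith

end Point

end TreeKernel

end TreeKernel

section EquivariantKernel

variable {G : Type u} [Group G] {χ : Character G} {A : Type u} [MulAction G A]

/-- An ultrametric kernel on a `G`-set that is equivariant when `g` shifts the levels by `χ g`, so
that `G` acts on its tree. -/
structure EquivariantKernel (χ : Character G) (A : Type u) [MulAction G A] extends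
    TreeKernel A where
  meet_smul : ∀ g a b, meet (g • a) (g • b) = χ.val g + meet a b

namespace EquivariantKernel

variable {K : EquivariantKernel χ A}

instance : MulAction G K.Point where
  smul g p := ⟨g • p.base, χ.val g + p.level, by
    rw [K.meet_smul]
    exact add_le_add_right p.le _⟩
  one_smul p := TreeKernel.Point.ext (one_smul G _) <|
    show χ.val 1 + p.level = p.level by rw [Character.val_one, zero_add]
  mul_smul g h p := TreeKernel.Point.ext (mul_smul g h _) <|
    show χ.val (g * h) + p.level = χ.val g + (χ.val h + p.level) by
      rw [Character.val_mul, add_assoc]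

theorem base_smul (g : G) (p : K.Point) : (g • p).base = g • p.base := rfl

theorem level_smul (g : G) (p : K.Point) : (g • p).level = χ.val g + p.level := rfl

theorem point_meet_smul (g : G) (p q : K.Point) :
    (g • p).meet (g • q) = χ.val g + p.meet q := by
  rw [TreeKernel.Point.meet, TreeKernel.Point.meet, base_smul, base_smul, K.meet_smul, level_smul,
    level_smul, min_add_add_left, min_add_add_left]

theorem smul_down (g : G) (p : K.Point) (v : NNReal) : g • p.down v = (g • p).down v :=
  TreeKernel.Point.ext rfl (add_sub_assoc _ _ _).symm

instance : IsIsometricSMul G K.Point where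
  isometry_smul g := Isometry.of_dist_eq fun p q => by
    rw [TreeKernel.Point.dist_def, TreeKernel.Point.dist_def, point_meet_smul, level_smul,
      level_smul]
    ring

instance : IsIsometricSMul G K.Tree where
  isometry_smul g := Isometry.of_dist_eq fun x y => by
    obtain ⟨p, rfl⟩ := SeparationQuotient.surjective_mk x
    obtain ⟨q, rfl⟩ := SeparationQuotient.surjective_mk y
    exact dist_smul g p q

theorem translate_ray (g : G) (p : K.Point) : p.ray.translate g = (g • p).ray :=
  GeodesicRay.ext fun v => congrArg SeparationQuotient.mk (smul_down g p v)

theorem fixesEnd_toEnd (o : K.Point) : FixesEnd G o.toEnd := fun g =>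
  (congrArg (Quotient.mk _) (translate_ray g o)).trans ((g • o).toEnd_eq o)

theorem hasAssociatedCharacter_toEnd (o : K.Point) (b : K.Tree) :
    HasAssociatedCharacter (endMeasure o.toEnd b) χ := by
  intro g a
  obtain ⟨p, rfl⟩ := SeparationQuotient.surjective_mk a
  obtain ⟨q, rfl⟩ := SeparationQuotient.surjective_mk b
  rw [← SeparationQuotient.mk_smul, TreeKernel.Point.endMeasure_toEnd,
    TreeKernel.Point.endMeasure_toEnd, level_smul]
  ring

theorem exists_le_meet_smul (hχ : χ ≠ 0) {L : Set K.Tree} (hL : IsGeodesicLine L)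
    (hinv : IsInvariantSet G L) : ∃ a r, ∀ g, 0 ≤ χ.val g → r ≤ K.meet a (g • a) := by
  obtain ⟨p, hp⟩ : ∃ p : K.Point, SeparationQuotient.mk p ∈ L := by
    obtain ⟨φ, -, rfl⟩ := hL
    obtain ⟨p, hp⟩ := SeparationQuotient.surjective_mk (φ 0)
    exact ⟨p, 0, hp.symm⟩
  have hsmul (g : G) : SeparationQuotient.mk (g • p) ∈ L := (hinv g).subset ⟨_, hp, rfl⟩
  have hlow (r : ℝ) : ∃ w : K.Point, w.level < r ∧ SeparationQuotient.mk w ∈ L := by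
    obtain ⟨g, hg⟩ := Character.exists_lt_val hχ (p.level - r)
    refine ⟨g⁻¹ • p, ?_, hsmul _⟩
    rw [level_smul, Character.val_inv]
    linarith
  refine ⟨p.base, p.level, fun g hg => ?_⟩
  have hle : p.level ≤ (g • p).level := le_add_of_nonneg_left hg
  exact (TreeKernel.Point.meet_eq_level_of_mem_isGeodesicLine hL hlow hp (hsmul g) hle).ge.trans
    (TreeKernel.Point.meet_le_meet_base p (g • p))

end EquivariantKernel

end EquivariantKernel

section CayleyKernel

variable {G : Type u} [Group G] {X : Type u} {η : X → G} {χ : Character G} {r : ℝ} {g h : G}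

/-- The supremum of the levels `r` for which `g` and `h` lie in the same connected component of
`upperGraph η χ r`. -/
noncomputable def joinLevel (η : X → G) (χ : Character G) (g h : G) : ℝ :=
  sSup {r | JoinedAbove η χ r g h}

theorem JoinedAbove.le_joinLevel (H : JoinedAbove η χ r g h) : r ≤ joinLevel η χ g h :=
  le_csSup ⟨χ.val g, fun _ H => H.le_left⟩ H

theorem joinedAbove_of_lt_joinLevel (hη : IsGeneratingSystem η) (hr : r < joinLevel η χ g h) :
    JoinedAbove η χ r g h := by
  obtain ⟨s, hs, hrs⟩ := exists_lt_of_lt_csSup (hη.exists_joinedAbove χ g h) hr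
  exact JoinedAbove.mono hrs.le hs

theorem joinLevel_comm (η : X → G) (χ : Character G) (g h : G) :
    joinLevel η χ g h = joinLevel η χ h g :=
  congrArg sSup (Set.ext fun _ => ⟨JoinedAbove.symm, JoinedAbove.symm⟩)

theorem min_joinLevel_joinLevel_le (hη : IsGeneratingSystem η) (χ : Character G) (a b c : G) :
    min (joinLevel η χ a b) (joinLevel η χ b c) ≤ joinLevel η χ a c :=
  le_of_forall_lt_imp_le_of_dense fun _ hr =>
    ((joinedAbove_of_lt_joinLevel hη (lt_min_iff.1 hr).1).trans
      (joinedAbove_of_lt_joinLevel hη (lt_min_iff.1 hr).2)).le_joinLevel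

theorem add_joinLevel_le (hη : IsGeneratingSystem η) (χ : Character G) (k g h : G) :
    χ.val k + joinLevel η χ g h ≤ joinLevel η χ (k * g) (k * h) := by
  refine le_of_forall_lt_imp_le_of_dense fun r hr => ?_
  have H := (joinedAbove_of_lt_joinLevel hη (sub_lt_iff_lt_add'.2 hr)).mul_left k
  rw [add_sub_cancel] at H
  exact H.le_joinLevel

theorem joinLevel_mul_left (hη : IsGeneratingSystem η) (χ : Character G) (k g h : G) :
    joinLevel η χ (k * g) (k * h) = χ.val k + joinLevel η χ g h := by
  refine le_antisymm ?_ (add_joinLevel_le hη χ k g h)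
  have hle := add_joinLevel_le hη χ k⁻¹ (k * g) (k * h)
  rw [inv_mul_cancel_left, inv_mul_cancel_left, Character.val_inv] at hle
  linarith

/-- The kernel on `G` whose tree is the continuous analogue of `T(G, X, χ)`: the point of level `r`
on the ray of `g` stands for the component of `g` in `upperGraph η χ r`. -/
noncomputable def cayleyKernel (hη : IsGeneratingSystem η) (χ : Character G) :
    EquivariantKernel χ G where
  meet := joinLevel η χ
  symm := joinLevel_comm η χ
  ultra := min_joinLevel_joinLevel_le hη χ
  meet_smul := joinLevel_mul_left hη χ

theorem upperGraph_connected_of_isGeodesicLine (hη : IsGeneratingSystem η) (hχ : χ ≠ 0)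
    {L : Set (cayleyKernel hη χ).Tree} (hL : IsGeodesicLine L) (hinv : IsInvariantSet G L) :
    (upperGraph η χ 0).Connected := by
  obtain ⟨a, r, har⟩ := EquivariantKernel.exists_le_meet_smul hχ hL hinv
  refine upperGraph_connected_of_joinedAbove hη hχ (r := r - χ.val a - 1) fun h hh => ?_
  refine joinedAbove_of_lt_joinLevel hη ?_
  have hr : r ≤ joinLevel η χ a (a * h) := by
    have hconj := har (a * h * a⁻¹) (by simpa using hh)
    rwa [smul_eq_mul, inv_mul_cancel_right] at hconj
  have hshift := joinLevel_mul_left hη χ a 1 h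
  rw [mul_one] at hshift
  linarith

end CayleyKernel

end SigmaOne

theorem theoremC2p43 {G : Type u} [Group G] (χ : SigmaOne.Character G) (hχ : χ ≠ 0) :
    List.TFAE [
      rayOfNeZero ℝ χ hχ ∈ SigmaOne.sigmaOne G,
      ∀ (X : Type u) (η : X → G), SigmaOne.IsGeneratingSystem η →
        SigmaOne.IsMeasuredLine (SigmaOne.CayleyTree.lam η χ) Set.univ,
      ∀ (T : Type u) [PartialOrder T] [MulAction G T] (lam : T → ℝ),
        SigmaOne.IsMeasuredGTree G lam → SigmaOne.HasAssociatedCharacter lam χ →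
        ∃ L : Set T, SigmaOne.IsMeasuredLine lam L ∧ SigmaOne.IsInvariantSet G L,
      ∀ (T : Type u) [MetricSpace T] [MulAction G T] [IsIsometricSMul G T],
        SigmaOne.IsRTree T → ∀ e : SigmaOne.TreeEnd T, SigmaOne.FixesEnd G e →
        (∀ b : T, SigmaOne.HasAssociatedCharacter (SigmaOne.endMeasure e b) χ) →
        ∃ L : Set T, SigmaOne.IsGeodesicLine L ∧ SigmaOne.IsInvariantSet G L] := by
  rw [SigmaOne.rayOfNeZero_mem_sigmaOne_iff]
  tfae_have 1 ↔ 2 := forall₃_congr fun X η _ =>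
    (SigmaOne.CayleyTree.isMeasuredLine_univ_iff hχ).symm
  tfae_have 1 → 3 := fun H T _ _ lam h hlam => h.exists_invariant_line hχ H hlam
  tfae_have 3 → 4 := by
    intro H T _ _ _ hT e he hχe
    obtain ⟨σ, -⟩ := Quotient.exists_rep e
    let b := σ.toFun 0
    let _ := hT.endOrder e
    obtain ⟨L, hL, hinv⟩ := H T (SigmaOne.endMeasure e b)
      (hT.isMeasuredGTree_endMeasure he b (hχe b)) (hχe b)
    exact ⟨L, hT.isGeodesicLine_of_isMeasuredLine e hL, hinv⟩
  tfae_have 4 → 1 := by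
    intro H X η hη
    let K := SigmaOne.cayleyKernel hη χ
    let o : K.Point := ⟨1, K.meet 1 1, le_rfl⟩
    obtain ⟨L, hL, hinv⟩ := H K.Tree K.isRTree o.toEnd
      (SigmaOne.EquivariantKernel.fixesEnd_toEnd o)
      (SigmaOne.EquivariantKernel.hasAssociatedCharacter_toEnd o)
    exact SigmaOne.upperGraph_connected_of_isGeodesicLine hη hχ hL hinv
  tfae_finish
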